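/- **Conventions.** For a distribution $V$ on $\mathbb R$ write $\overline V(x)=V((x,\infty))$. $V\in\mathcal L$ (long-tailed) means $\overline V(x)>0$ for all $x>0$ and $\overline V(x-a)/\overline V(x)\to1$ as $x\to\infty$ for every $a>0$; $V\in\mathcal D$ (dominatedly varying) means $\overline V(x)>0$ for all $x>0$ and $\limsup_{x\to\infty}\overline V(tx)/\overline V(x)<\infty$ for every $0<t<1$. Write $x\wedge y=\min\{x,y\}$, $X^-=\max\{-X,0\}$; $f(x,y)\sim c\,g(x,y)$ means $f/g\to c$ as $x\wedge y\to\infty$. Random variables $X\sim F$ and $Y\sim G$ are *strongly asymptotically independent* (SAI) with constant $C>0$ if, as $x\wedge y\to\infty$, $$P(X^->x,Y>y)=O\big(F(-x)\overline G(y)\big),\quad P(X>x,Y^->y)=O\big(\overline F(x)G(-y)\big),\quad P(X>x,Y>y)\sim C\,\overline F(x)\overline G(y).$$ Random variables $X_1,\dots,X_n,Y_1,\dots,Y_m$ are *generalized tail asymptotically independent* (GTAI) if $$\lim_{x_i\wedge x_k\wedge y_j\to\infty}P(|X_i|>x_i\mid X_k>x_k,\,Y_j>y_j)=0\quad(1\le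 k\ne i\le n,\ 1\le j\le m),$$ $$\lim_{x_i\wedge y_j\wedge y_k\to\infty}P(|Y_j|>y_j\mid X_i>x_i,\,Y_k>y_k)=0\quad(1\le j\ne k\le m,\ 1\le i\le n).$$ **Statement.** Let $(X_i,Y_i)_{i\ge1}$ be identically distributed pairs of real random variables with marginal distributions $F,G\in\mathcal D\cap\mathcal L$, such that $X_1,\dots,X_n,Y_1,\dots,Y_m$ are GTAI for all $n,m\in\mathbb N$, $X_i$ and $Y_i$ are SAI with constant $C>0$ for every $i$, and $X_i$ and $Y_j$ are independent whenever $i\ne j$. Let $(\theta_i)_{i\ge1}$ be i.i.d. positive random variables, the sequence $(\theta_i)_{i\ge1}$ being independent of the sequence $(X_i,Y_i)_{i\ge1}$. Put $T_i=\theta_1+\dots+\theta_i$, $N(t)=\#\{i\ge1:T_i\le t\}$ and $\lambda(t)=E[N(t)]=\sum_{i\ge1}P(T_i\le t)$, and let $\lambda(dt)$ be the measure on $[0,\infty)$ with distribution function $\lambda$. For $r\ge0$ put $$D^{(1)}_r(t)=\sum_{i=1}^{N(t)}X_ie^{-rT_i},\qquad D^{(2)}_r(t)=\sum_{j=1}^{N(t)}Y_je^{-rT_j}.$$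 Then for every finite $T>0$ with $\lambda(T)>0$, $$P\big[D^{(1)}_r(T)>x,\ D^{(2)}_r(T)>y\big]\sim\Delta(x,y;T)\qquad\text{as }x\wedge y\to\infty,$$ where $$\Delta(x,y;T)=\iint_{s,t\ge0,\ s+t\le T}\Big[\overline F(xe^{r(t+s)})\overline G(ye^{rt})+\overline F(xe^{rt})\overline G(ye^{r(t+s)})\Big]\lambda(ds)\,\lambda(dt)+C\int_0^T\overline F(xe^{rt})\,\overline G(ye^{rt})\,\lambda(dt).$$ -/

import Mathlib

open MeasureTheory ProbabilityTheory Filter Topology Asymptotics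

noncomputable section

namespace RiskModel

/-! ### Distribution classes -/

/-- The tail `V̄(x) = V((x, ∞)) = 1 - V(x)` of a distribution `V` on the real line. -/
def tail (V : Measure ℝ) (x : ℝ) : ℝ := V.real (Set.Ioi x)

/-- Infinite right endpoint: `V̄(x) > 0` for all `x > 0`. -/
def InfiniteRightEndpoint (V : Measure ℝ) : Prop := ∀ x : ℝ, 0 < x → 0 < tail V x

/-- The class `ℒ` of long-tailed distributions. -/
structure LongTailed (V : Measure ℝ) : Prop where
  endpoint : InfiniteRightEndpoint V
  tendsto_one : ∀ a : ℝ, 0 < a →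
    Tendsto (fun x : ℝ => tail V (x - a) / tail V x) atTop (𝓝 1)

/-- The class `𝒟` of dominatedly varying distributions:
`limsup V̄(t x) / V̄(x) < ∞` as `x → ∞`, for all `0 < t < 1`. -/
structure DominatedlyVarying (V : Measure ℝ) : Prop where
  endpoint : InfiniteRightEndpoint V
  bounded : ∀ t : ℝ, 0 < t → t < 1 →
    IsBoundedUnder (· ≤ ·) atTop (fun x : ℝ => tail V (t * x) / tail V x)

/-! ### The limits `x ∧ y → ∞` and `x ∧ y ∧ z → ∞` -/

/-- The filter of the convergence `x ∧ y → ∞`. -/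
def minAtTop : Filter (ℝ × ℝ) := comap (fun p : ℝ × ℝ => min p.1 p.2) atTop

/-- The filter of the convergence `x ∧ y ∧ z → ∞`. -/
def minAtTop₃ : Filter (ℝ × ℝ × ℝ) :=
  comap (fun p : ℝ × ℝ × ℝ => min p.1 (min p.2.1 p.2.2)) atTop

/-! ### Dependence structures -/

variable {Ω : Type*} [MeasurableSpace Ω]

/-- `X` and `Y` are strongly asymptotically independent (SAI) with constant `C > 0`. Here
`max (-X) 0` is the negative part of `X`, and `cdf (P.map X) (-x) = P(X ≤ -x)`. -/
structure IsSAI (P : Measure Ω) (X Y : Ω → ℝ) (C : ℝ) : Prop where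
  pos : 0 < C
  neg_left : (fun p : ℝ × ℝ => P.real {ω | p.1 < max (-(X ω)) 0 ∧ p.2 < Y ω})
    =O[minAtTop] fun p : ℝ × ℝ => cdf (P.map X) (-p.1) * tail (P.map Y) p.2
  neg_right : (fun p : ℝ × ℝ => P.real {ω | p.1 < X ω ∧ p.2 < max (-(Y ω)) 0})
    =O[minAtTop] fun p : ℝ × ℝ => tail (P.map X) p.1 * cdf (P.map Y) (-p.2)
  tendsto_const : Tendsto (fun p : ℝ × ℝ => P.real {ω | p.1 < X ω ∧ p.2 < Y ω} /
    (tail (P.map X) p.1 * tail (P.map Y) p.2)) minAtTop (𝓝 C)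

/-- The two families `X` and `Y` are generalized tail asymptotically independent (GTAI);
`P[|B]` is the conditional probability measure given the event `B`. -/
structure IsGTAI {ι κ : Type*} (P : Measure Ω) (X : ι → Ω → ℝ) (Y : κ → Ω → ℝ) : Prop where
  left : ∀ (i k : ι) (j : κ), k ≠ i →
    Tendsto (fun p : ℝ × ℝ × ℝ =>
      (P[|{ω | p.2.1 < X k ω ∧ p.2.2 < Y j ω}]).real {ω | p.1 < |X i ω|}) minAtTop₃ (𝓝 0)
  right : ∀ (j k : κ) (i : ι), j ≠ k →
    Tendsto (fun p : ℝ × ℝ × ℝ =>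
      (P[|{ω | p.2.1 < X i ω ∧ p.2.2 < Y k ω}]).real {ω | p.1 < |Y j ω|}) minAtTop₃ (𝓝 0)

/-! ### Renewal process and discounted aggregate claims

Sequences are indexed from `0`: `X 0`, `θ 0` are the first claim and the first inter-arrival time. -/

/-- `N` is driven by the inter-arrival times `θ`: i.i.d. and (almost surely) positive. -/
structure IsRenewal (P : Measure Ω) (θ : ℕ → Ω → ℝ) : Prop where
  measurable : ∀ i, Measurable (θ i)
  indep : iIndepFun θ P
  ident : ∀ i, IdentDistrib (θ i) (θ 0) P P
  pos : ∀ i, ∀ᵐ ω ∂P, 0 < θ i ω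

/-- Arrival times: `arrival θ i = θ 0 + ⋯ + θ i` is the `(i + 1)`-st arrival time. -/
def arrival (θ : ℕ → Ω → ℝ) (i : ℕ) (ω : Ω) : ℝ := ∑ k ∈ Finset.range (i + 1), θ k ω

/-- The counting process `N(t)`: the number of arrivals up to time `t`. -/
def counting (θ : ℕ → Ω → ℝ) (t : ℝ) (ω : Ω) : ℕ∞ := {i : ℕ | arrival θ i ω ≤ t}.encard

/-- The renewal function `λ(t) = E[N(t)]`. -/
def renewalFunction (P : Measure Ω) (θ : ℕ → Ω → ℝ) (t : ℝ) : ENNReal :=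
  ∫⁻ ω, (counting θ t ω : ENNReal) ∂P

/-- The renewal measure `λ(dt)`: the sum of the laws of the arrival times. -/
def renewalMeasure (P : Measure Ω) (θ : ℕ → Ω → ℝ) : Measure ℝ :=
  Measure.sum fun i : ℕ => P.map (arrival θ i)

/-- The renewal measure is the Stieltjes measure of the renewal function. -/
theorem renewalMeasure_Iic (P : Measure Ω) (θ : ℕ → Ω → ℝ) (hθ : ∀ i, Measurable (θ i)) (t : ℝ) :
    renewalMeasure P θ (Set.Iic t) = renewalFunction P θ t := by
  have hm : ∀ i, Measurable (arrival θ i) := fun i =>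
    Finset.measurable_fun_sum _ fun k _ => hθ k
  have hs : ∀ i, MeasurableSet {ω | arrival θ i ω ≤ t} := fun i =>
    measurableSet_le (hm i) measurable_const
  have key : ∀ ω, (counting θ t ω : ENNReal)
      = ∑' i : ℕ, Set.indicator {ω | arrival θ i ω ≤ t} (fun _ => (1 : ENNReal)) ω := by
    intro ω
    rw [counting, ← ENNReal.tsum_set_one, tsum_subtype {i : ℕ | arrival θ i ω ≤ t} fun _ => 1]
    rfl
  simp only [renewalFunction, renewalMeasure, key]
  rw [lintegral_tsum fun i => (measurable_const.indicator (hs i)).aemeasurable,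
    Measure.sum_apply _ measurableSet_Iic]
  refine tsum_congr fun i => ?_
  rw [Measure.map_apply (hm i) measurableSet_Iic, lintegral_indicator (hs i)]
  simp [Set.preimage, Set.Iic]

instance (P : Measure Ω) [IsProbabilityMeasure P] (θ : ℕ → Ω → ℝ) :
    SFinite (renewalMeasure P θ) := by
  unfold renewalMeasure; infer_instance

/-- Discounted aggregate claims `D_r(t) = ∑_{i ≤ N(t)} Z_i e^{-r T_i}` of the claims `Z` (for
positive inter-arrival times, `N(t)` is almost surely finite). -/
def discountedClaims (r : ℝ) (θ Z : ℕ → Ω → ℝ) (t : ℝ) (ω : Ω) : ℝ :=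
  ∑ i ∈ Finset.range (counting θ t ω).toNat, Z i ω * Real.exp (-r * arrival θ i ω)

/-- The function `Δ(x, y; T)`, with `lam` the renewal measure. -/
def deltaAsymp (F G lam : Measure ℝ) (r C T x y : ℝ) : ℝ :=
  (∫ p in {p : ℝ × ℝ | 0 ≤ p.1 ∧ 0 ≤ p.2 ∧ p.1 + p.2 ≤ T},
      (tail F (x * Real.exp (r * (p.2 + p.1))) * tail G (y * Real.exp (r * p.2)) +
        tail F (x * Real.exp (r * p.2)) * tail G (y * Real.exp (r * (p.2 + p.1))))
      ∂(lam.prod lam)) +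
  C * ∫ t in Set.Icc 0 T, tail F (x * Real.exp (r * t)) * tail G (y * Real.exp (r * t)) ∂lam

end RiskModel

end

noncomputable section

namespace RiskModel

/-! ### The filters `minAtTop` and `minAtTop₃` -/

/-! The proof is a principle of one large jump in each coordinate, made uniform enough to be
averaged over the arrival times.

Fix the arrival times, hence the number `n` of claims and the weights `e^{-r T_i}` in `(0, 1]`. Both
weighted sums are large essentially because exactly one `X i` and one `Y j` are large. By GTAI, a
third claim above a high but fixed level `l` is negligible given two large ones; the remaining
claims then move each sum by at most `l`, which long tails do not see. Independence (`i ≠ j`) and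
SAI (`i = j`) evaluate the tails of the pairs. Thus the joint tail is the sum over pairs of `w F̄(x
e^{r T_i}) Ḡ(y e^{r T_j})`, with `w = C` on the diagonal and `1` off it, up to `o(F̄(x) Ḡ(y))`
(`tendsto_sum_tail`).

Dominated variation bounds the joint tail by `K (n + 1)^q F̄(x) Ḡ(y)`, uniformly in the weights
(`exists_sum_tail_bound`). Since `N(T)` has all moments, dominated convergence integrates the
asymptotics over the arrival times (`tendsto_discounted_sub`). The expected sum over pairs is `Δ`
(`integral_sum_pairs`): for two distinct arrivals, the earlier time and the gap are independent and
both distributed as arrival times, which gives the double integral; the diagonal gives the single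
one.

Finally `Δ ≥ c F̄(x) Ḡ(y)` with `c > 0` (`exists_le_deltaAsymp`), so the additive error is also a
relative one. -/

theorem minAtTop_eq_prod : minAtTop = (atTop : Filter ℝ) ×ˢ (atTop : Filter ℝ) := by
  apply le_antisymm
  · refine le_prod.2 ⟨?_, ?_⟩
    · exact tendsto_atTop_mono (fun p => min_le_left p.1 p.2) tendsto_comap
    · exact tendsto_atTop_mono (fun p => min_le_right p.1 p.2) tendsto_comap
  · rw [minAtTop, ← tendsto_iff_comap]
    exact tendsto_atTop.2 fun b => by
      filter_upwards [(eventually_ge_atTop b).prod_mk (eventually_ge_atTop b)] with p hp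
      exact le_min hp.1 hp.2

theorem minAtTop₃_eq_prod :
    minAtTop₃ = (atTop : Filter ℝ) ×ˢ ((atTop : Filter ℝ) ×ˢ (atTop : Filter ℝ)) := by
  have h : minAtTop₃ = comap (fun p : ℝ × ℝ × ℝ => min p.1 (min p.2.1 p.2.2)) atTop := rfl
  have h3 : Tendsto (fun p : ℝ × ℝ × ℝ => min p.1 (min p.2.1 p.2.2)) minAtTop₃ atTop :=
    h ▸ tendsto_comap
  apply le_antisymm
  · refine le_prod.2 ⟨?_, le_prod.2 ⟨tendsto_map'_iff.2 ?_, tendsto_map'_iff.2 ?_⟩⟩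
    · exact tendsto_atTop_mono (fun p => min_le_left _ _) h3
    · exact tendsto_atTop_mono (fun p => (min_le_right _ _).trans (min_le_left _ _)) h3
    · exact tendsto_atTop_mono (fun p => (min_le_right _ _).trans (min_le_right _ _)) h3
  · rw [h, ← tendsto_iff_comap]
    exact tendsto_atTop.2 fun b => by
      filter_upwards [(eventually_ge_atTop b).prod_mk
        ((eventually_ge_atTop b).prod_mk (eventually_ge_atTop b))] with p hp
      exact le_min hp.1 (le_min hp.2.1 hp.2.2)

/-- Dominated convergence along `minAtTop` needs a countably generated filter. -/
instance : minAtTop.IsCountablyGenerated := by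
  rw [minAtTop_eq_prod]; infer_instance

theorem tendsto_fst_minAtTop : Tendsto Prod.fst minAtTop (atTop : Filter ℝ) := by
  rw [minAtTop_eq_prod]; exact tendsto_fst

theorem tendsto_snd_minAtTop : Tendsto Prod.snd minAtTop (atTop : Filter ℝ) := by
  rw [minAtTop_eq_prod]; exact tendsto_snd

theorem Tendsto.prodMk_minAtTop {α : Type*} {l : Filter α} {f g : α → ℝ}
    (hf : Tendsto f l atTop) (hg : Tendsto g l atTop) :
    Tendsto (fun a => (f a, g a)) l minAtTop := by
  rw [minAtTop_eq_prod]; exact hf.prodMk hg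

theorem eventually_minAtTop_ge (b : ℝ) : ∀ᶠ p in minAtTop, b ≤ p.1 ∧ b ≤ p.2 := by
  rw [minAtTop_eq_prod]
  exact (eventually_ge_atTop b).prod_mk (eventually_ge_atTop b)

/-! ### Tails -/

theorem tail_nonneg (V : Measure ℝ) (x : ℝ) : 0 ≤ tail V x := measureReal_nonneg

theorem tail_le_one (V : Measure ℝ) [IsProbabilityMeasure V] (x : ℝ) : tail V x ≤ 1 :=
  measureReal_le_one

theorem tail_antitone (V : Measure ℝ) [IsFiniteMeasure V] : Antitone (tail V) :=
  fun _ _ h => measureReal_mono (Set.Ioi_subset_Ioi h)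

theorem measurable_tail (V : Measure ℝ) [IsFiniteMeasure V] : Measurable (tail V) :=
  (tail_antitone V).measurable

theorem InfiniteRightEndpoint.tail_pos {V : Measure ℝ} [IsFiniteMeasure V]
    (h : InfiniteRightEndpoint V) (x : ℝ) : 0 < tail V x :=
  (h (max x 1) (by positivity)).trans_le (tail_antitone V (le_max_left _ _))

theorem tail_map {Ω : Type*} [MeasurableSpace Ω] (P : Measure Ω) {Z : Ω → ℝ} (hZ : Measurable Z)
    (x : ℝ) : tail (P.map Z) x = P.real {ω | x < Z ω} := by
  rw [tail, measureReal_def, Measure.map_apply hZ measurableSet_Ioi]; rfl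

/-- A long-tailed distribution is insensitive to shifts by constants. -/
theorem LongTailed.tendsto_add {V : Measure ℝ} [IsFiniteMeasure V] (h : LongTailed V) (s : ℝ) :
    Tendsto (fun x => tail V (x + s) / tail V x) atTop (𝓝 1) := by
  rcases lt_trichotomy s 0 with hs | rfl | hs
  · simpa using h.tendsto_one (-s) (by linarith)
  · have : ∀ x, tail V (x + 0) / tail V x = 1 := fun x => by
      rw [add_zero, div_self (h.endpoint.tail_pos x).ne']
    simp only [this, tendsto_const_nhds]
  · have h1 := ((h.tendsto_one s hs).comp (tendsto_atTop_add_const_right atTop s tendsto_id)).inv₀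
      one_ne_zero
    simpa using h1

/-- A dominatedly varying tail satisfies a doubling inequality, iterated. -/
theorem DominatedlyVarying.exists_pow_two_bound {V : Measure ℝ} [IsProbabilityMeasure V]
    (h : DominatedlyVarying V) : ∃ A M x₀ : ℝ, 0 < A ∧ 1 ≤ M ∧ 0 < x₀ ∧
      ∀ k : ℕ, ∀ x, x₀ ≤ x → tail V (x / 2 ^ k) ≤ A * M ^ k * tail V x := by
  obtain ⟨M, hM⟩ := h.bounded (1 / 2) (by norm_num) (by norm_num)
  obtain ⟨x₁, hx₁⟩ := eventually_atTop.1 (eventually_map.1 hM)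
  have hp := h.endpoint.tail_pos
  set x₀ := max x₁ 1
  have hhalf : ∀ x, x₀ ≤ x → tail V (x / 2) ≤ max M 1 * tail V x := fun x hx => by
    have := (div_le_iff₀ (hp x)).1 (hx₁ x ((le_max_left _ _).trans hx))
    rw [one_div, inv_mul_eq_div] at this
    exact this.trans (mul_le_mul_of_nonneg_right (le_max_left _ _) (hp x).le)
  -- The factor `(tail V x₀)⁻¹` covers the points `x` with `x / 2 ≤ x₀`, where the induction
  -- hypothesis is not available at `x / 2`: the trivial bound `1` is then at most `(tail V x₀)⁻¹ *
  -- tail V (x / 2)`.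
  have hA : 1 ≤ (tail V x₀)⁻¹ := (one_le_inv₀ (hp x₀)).2 (tail_le_one V x₀)
  have hM1 : 1 ≤ max M 1 := le_max_right _ _
  refine ⟨(tail V x₀)⁻¹, max M 1, x₀, by positivity, hM1, by positivity, fun k => ?_⟩
  induction k with
  | zero =>
    intro x _
    simpa using le_mul_of_one_le_left (hp x).le hA
  | succ k ih =>
    intro x hx
    have hk : (1 : ℝ) ≤ max M 1 ^ k := one_le_pow₀ hM1
    have key : tail V (x / 2 ^ (k + 1)) ≤ (tail V x₀)⁻¹ * max M 1 ^ k * tail V (x / 2) := by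
      rcases le_total x₀ (x / 2) with h2 | h2
      · have := ih (x / 2) h2
        rwa [div_div, ← pow_succ'] at this
      · calc tail V (x / 2 ^ (k + 1)) ≤ 1 := tail_le_one V _
          _ = (tail V x₀)⁻¹ * tail V x₀ := (inv_mul_cancel₀ (hp x₀).ne').symm
          _ ≤ (tail V x₀)⁻¹ * tail V (x / 2) :=
            mul_le_mul_of_nonneg_left (tail_antitone V h2) (by positivity)
          _ ≤ (tail V x₀)⁻¹ * max M 1 ^ k * tail V (x / 2) := by
            have := hp (x / 2)
            rw [mul_assoc]
            exact mul_le_mul_of_nonneg_left (le_mul_of_one_le_left this.le hk) (by positivity)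
    refine key.trans ?_
    rw [pow_succ, ← mul_assoc, mul_assoc (_ * _) (max M 1)]
    exact mul_le_mul_of_nonneg_left (hhalf x hx) (by positivity)

/-- Potter-type bound: dominatedly varying tails grow at most polynomially under scaling. -/
theorem DominatedlyVarying.exists_polynomial_bound {V : Measure ℝ} [IsProbabilityMeasure V]
    (h : DominatedlyVarying V) : ∃ (K x₀ : ℝ) (q : ℕ), 0 < K ∧ 0 < x₀ ∧
      ∀ n : ℕ, 1 ≤ n → ∀ x, x₀ ≤ x → tail V (x / n) ≤ K * n ^ q * tail V x := by
  obtain ⟨A, M, x₀, hA, hM, hx₀, hb⟩ := h.exists_pow_two_bound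
  -- With `M < 2 ^ q` and `n ≤ 2 ^ k ≤ 2 n`, the geometric factor `M ^ k` is at most `(2 n) ^ q`, a
  -- polynomial in `n`.
  obtain ⟨q, hq⟩ := pow_unbounded_of_one_lt M (one_lt_two : (1 : ℝ) < 2)
  refine ⟨A * 2 ^ q, x₀, q, by positivity, hx₀, fun n hn x hx => ?_⟩
  obtain ⟨k, hk1, hk2⟩ : ∃ k : ℕ, n ≤ 2 ^ k ∧ 2 ^ k ≤ 2 * n := by
    refine ⟨Nat.log 2 n + 1, (Nat.lt_pow_succ_log_self one_lt_two n).le, ?_⟩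
    rw [pow_succ']
    exact Nat.mul_le_mul_left 2 (Nat.pow_log_le_self 2 (by omega))
  have hk1' : (n : ℝ) ≤ 2 ^ k := by exact_mod_cast hk1
  have hk2' : (2 : ℝ) ^ k ≤ 2 * n := by exact_mod_cast hk2
  have hn' : (0 : ℝ) < n := by exact_mod_cast hn
  have hx' : 0 ≤ x := hx₀.le.trans hx
  have hT := tail_nonneg V x
  calc tail V (x / n) ≤ tail V (x / 2 ^ k) := tail_antitone V (by gcongr)
    _ ≤ A * M ^ k * tail V x := hb k x hx
    _ ≤ A * (2 * n) ^ q * tail V x := by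
      have : M ^ k ≤ (2 * n) ^ q := calc
        M ^ k ≤ (2 ^ q) ^ k := by gcongr
        _ = (2 ^ k) ^ q := by rw [← pow_mul, ← pow_mul, mul_comm]
        _ ≤ (2 * n) ^ q := by gcongr
      gcongr
    _ = A * 2 ^ q * n ^ q * tail V x := by rw [mul_pow]; ring

section
variable {Ω : Type*} [MeasurableSpace Ω]

/-- Two sequences of claims whose joint tails `P(X i > x, Y j > y)` are asymptotically constant
multiples of `F̄(x) Ḡ(y)` (the multiple being `C` if `i = j`, and `1` otherwise), and for which a
third large claim is asymptotically negligible given a large claim in each sequence. -/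
structure FactorizingTails (P : Measure Ω) (X Y : ℕ → Ω → ℝ) (F G : Measure ℝ) (C : ℝ) :
    Prop where
  measurable_left : ∀ i, Measurable (X i)
  measurable_right : ∀ i, Measurable (Y i)
  longTailed_left : LongTailed F
  longTailed_right : LongTailed G
  dominated_left : DominatedlyVarying F
  dominated_right : DominatedlyVarying G
  joint_le : ∃ B, 0 < B ∧ ∀ i j u v,
    P.real {ω | u < X i ω ∧ v < Y j ω} ≤ B * (tail F u * tail G v)
  joint_tendsto : ∀ i j, Tendsto (fun p : ℝ × ℝ =>
    P.real {ω | p.1 < X i ω ∧ p.2 < Y j ω} / (tail F p.1 * tail G p.2)) minAtTop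
      (𝓝 (if i = j then C else 1))
  third_left : ∀ i j k, k ≠ i → ∀ ε > 0, ∀ᶠ l : ℝ in atTop, ∀ᶠ p : ℝ × ℝ in minAtTop,
    P.real {ω | (p.1 < X i ω ∧ p.2 < Y j ω) ∧ l < |X k ω|} ≤ ε * (tail F p.1 * tail G p.2)
  third_right : ∀ i j k, k ≠ j → ∀ ε > 0, ∀ᶠ l : ℝ in atTop, ∀ᶠ p : ℝ × ℝ in minAtTop,
    P.real {ω | (p.1 < X i ω ∧ p.2 < Y j ω) ∧ l < |Y k ω|} ≤ ε * (tail F p.1 * tail G p.2)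

/-! ### Deterministic facts on sums with one large term -/

/-- Pigeonhole: otherwise the sum is at most `n x / (n + 1) ≤ x`. The denominator `n + 1` stays
positive for `n = 0`, and serves equally for a sum with one term erased. -/
theorem exists_lt_of_lt_sum {s : Finset ℕ} {n : ℕ} (hs : s.card ≤ n) {z : ℕ → ℝ} {x : ℝ}
    (hx : 0 < x) (h : x < ∑ i ∈ s, z i) : ∃ k ∈ s, x / (n + 1) < z k := by
  by_contra! hc
  have hle : ∑ i ∈ s, z i ≤ s.card * (x / (n + 1)) := by
    simpa using Finset.sum_le_card_nsmul s z _ hc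
  have hcard : (s.card : ℝ) ≤ n := by exact_mod_cast hs
  have : s.card * (x / (n + 1)) ≤ x := by
    rw [mul_div_assoc', div_le_iff₀ (by positivity)]
    nlinarith
  linarith

/-- If the large term does not reach `x - l`, the other terms add up to more than `l`, and the
pigeonhole applies to them. -/
theorem exists_one_or_two_large {n : ℕ} {z : ℕ → ℝ} {x l : ℝ} (hx : 0 < x) (hl : 0 < l)
    (h : x < ∑ i ∈ Finset.range n, z i) :
    ∃ i ∈ Finset.range n, x / (n + 1) < z i ∧
      (x - l < z i ∨ ∃ k ∈ Finset.range n, k ≠ i ∧ l / (n + 1) < z k) := by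
  obtain ⟨i, hi, hxi⟩ := exists_lt_of_lt_sum (Finset.card_range n).le hx h
  refine ⟨i, hi, hxi, ?_⟩
  by_cases hxl : x - l < z i
  · exact Or.inl hxl
  · have := Finset.sum_erase_add _ z hi
    obtain ⟨k, hk, hlk⟩ := exists_lt_of_lt_sum (s := (Finset.range n).erase i) (n := n) (z := z)
      ((Finset.card_erase_le).trans (Finset.card_range n).le) hl (by linarith)
    exact Or.inr ⟨k, Finset.mem_of_mem_erase hk, Finset.ne_of_mem_erase hk, hlk⟩

/-- To pull the sum back to `x`, the negated remaining terms would have to add up to more than `l`,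
so one of them would exceed `l / (n + 1)`. -/
theorem lt_sum_of_one_large {n i : ℕ} (hi : i ∈ Finset.range n) {z : ℕ → ℝ} {x l : ℝ}
    (hl : 0 < l) (hz : x + l < z i) (h : ∀ k ∈ Finset.range n, k ≠ i → |z k| ≤ l / (n + 1)) :
    x < ∑ i ∈ Finset.range n, z i := by
  by_contra! hc
  have := Finset.sum_erase_add _ z hi
  obtain ⟨k, hk, hlk⟩ := exists_lt_of_lt_sum (s := (Finset.range n).erase i) (n := n)
    (z := fun k => -z k) ((Finset.card_erase_le).trans (Finset.card_range n).le) hl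
    (by rw [Finset.sum_neg_distrib]; linarith)
  have h1 := h k (Finset.mem_of_mem_erase hk) (Finset.ne_of_mem_erase hk)
  linarith [neg_abs_le (z k)]

/-- A large claim in each sequence, and a third claim of moderate size. -/
def badEvent (X Y : ℕ → Ω → ℝ) (n i j : ℕ) (l : ℝ) (p : ℝ × ℝ) : Set Ω :=
  {ω | (p.1 / (n + 1) < X i ω ∧ p.2 / (n + 1) < Y j ω) ∧
    ((∃ k ∈ Finset.range n, k ≠ i ∧ l / (n + 1) < |X k ω|) ∨
      ∃ k ∈ Finset.range n, k ≠ j ∧ l / (n + 1) < |Y k ω|)}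

/-! ### Joint tails of finite weighted sums -/

namespace FactorizingTails

variable {P : Measure Ω} {X Y : ℕ → Ω → ℝ} {F G : Measure ℝ} {C : ℝ}

theorem measurableSet_weighted (h : FactorizingTails P X Y F G C) (i j : ℕ) (a b u v : ℝ) :
    MeasurableSet {ω | u < X i ω * a ∧ v < Y j ω * b} :=
  (measurableSet_lt measurable_const ((h.measurable_left i).mul_const a)).inter
    (measurableSet_lt measurable_const ((h.measurable_right j).mul_const b))

theorem measurableSet_badEvent (h : FactorizingTails P X Y F G C) (n i j : ℕ) (l : ℝ)
    (p : ℝ × ℝ) : MeasurableSet (badEvent X Y n i j l p) := by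
  have hX := h.measurable_left
  have hY := h.measurable_right
  unfold badEvent
  measurability

/-- Upper bound for the joint tail of weighted sums by the joint tails of single terms. -/
theorem sum_tail_le [IsProbabilityMeasure P] {a : ℕ → ℝ} (ha : ∀ i, 0 < a i)
    (ha1 : ∀ i, a i ≤ 1) (n : ℕ) {x y l : ℝ} (hx : 0 < x)
    (hy : 0 < y) (hl : 0 < l) :
    P.real {ω | x < ∑ i ∈ Finset.range n, X i ω * a i ∧ y < ∑ i ∈ Finset.range n, Y i ω * a i} ≤
      ∑ q ∈ Finset.range n ×ˢ Finset.range n,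
        (P.real {ω | x + -l < X q.1 ω * a q.1 ∧ y + -l < Y q.2 ω * a q.2} +
          P.real (badEvent X Y n q.1 q.2 l (x, y))) := by
  -- Weights at most `1` can be dropped from a lower bound by a positive level; this is why
  -- `badEvent` does not involve the weights.
  have hle : ∀ {i : ℕ} {z u : ℝ}, 0 < u → u < z * a i → u < z := fun {i z u} hu hz => by
    have hz0 : 0 < z := pos_of_mul_pos_left (hu.trans hz) (ha i).le
    exact hz.trans_le (mul_le_of_le_one_right hz0.le (ha1 i))
  have hn : (0 : ℝ) < n + 1 := by positivity
  have hsub : {ω | x < ∑ i ∈ Finset.range n, X i ω * a i ∧ y < ∑ i ∈ Finset.range n, Y i ω * a i} ⊆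
      ⋃ q ∈ Finset.range n ×ˢ Finset.range n,
        ({ω | x + -l < X q.1 ω * a q.1 ∧ y + -l < Y q.2 ω * a q.2} ∪
          badEvent X Y n q.1 q.2 l (x, y)) := by
    rintro ω ⟨hωx, hωy⟩
    obtain ⟨i, hi, hxi, hi2⟩ := exists_one_or_two_large hx hl hωx
    obtain ⟨j, hj, hyj, hj2⟩ := exists_one_or_two_large hy hl hωy
    refine Set.mem_biUnion (x := (i, j)) (Finset.mem_coe.2 (Finset.mk_mem_product hi hj)) ?_
    have hbig : x / (n + 1) < X i ω ∧ y / (n + 1) < Y j ω :=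
      ⟨hle (div_pos hx hn) hxi, hle (div_pos hy hn) hyj⟩
    rcases hi2 with hi2 | ⟨k, hk, hki, hlk⟩
    · rcases hj2 with hj2 | ⟨k, hk, hkj, hlk⟩
      · exact Or.inl ⟨by linarith, by linarith⟩
      · exact Or.inr ⟨hbig, Or.inr ⟨k, hk, hkj,
          (hle (div_pos hl hn) hlk).trans_le (le_abs_self _)⟩⟩
    · exact Or.inr ⟨hbig, Or.inl ⟨k, hk, hki,
        (hle (div_pos hl hn) hlk).trans_le (le_abs_self _)⟩⟩
  refine (measureReal_mono hsub (measure_ne_top _ _)).trans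
    ((measureReal_biUnion_finset_le _ _).trans ?_)
  exact Finset.sum_le_sum fun q _ => measureReal_union_le _ _

/-- Lower bound for the joint tail of weighted sums by the joint tails of single terms. -/
theorem le_sum_tail [IsProbabilityMeasure P] {a : ℕ → ℝ}
    (h : FactorizingTails P X Y F G C) (ha : ∀ i, 0 < a i) (ha1 : ∀ i, a i ≤ 1)
    (n : ℕ) {x y l : ℝ} (hx : 0 < x) (hy : 0 < y) (hl : 0 < l) :
    ∑ q ∈ Finset.range n ×ˢ Finset.range n,
        (P.real {ω | x + l < X q.1 ω * a q.1 ∧ y + l < Y q.2 ω * a q.2} -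
          P.real (badEvent X Y n q.1 q.2 l (x, y))) ≤
      P.real {ω | x < ∑ i ∈ Finset.range n, X i ω * a i ∧
        y < ∑ i ∈ Finset.range n, Y i ω * a i} := by
  have hn : (1 : ℝ) ≤ n + 1 := by linarith [(Nat.cast_nonneg n : (0 : ℝ) ≤ n)]
  have hdiv : ∀ {u v z : ℝ} {i : ℕ}, 0 < u → 0 < v → u + v < z * a i →
      u / (n + 1) < z ∧ v / (n + 1) < z := fun {u v z i} hu hv hz => by
    have hz0 : 0 < z := pos_of_mul_pos_left ((add_pos hu hv).trans hz) (ha i).le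
    have hz1 := hz.trans_le (mul_le_of_le_one_right hz0.le (ha1 i))
    exact ⟨(div_le_self hu.le hn).trans_lt (by linarith),
      (div_le_self hv.le hn).trans_lt (by linarith)⟩
  set A : ℕ × ℕ → Set Ω := fun q => {ω | x + l < X q.1 ω * a q.1 ∧ y + l < Y q.2 ω * a q.2}
    with hA
  set E : ℕ × ℕ → Set Ω := fun q => A q \ badEvent X Y n q.1 q.2 l (x, y) with hE
  have hsub : (⋃ q ∈ Finset.range n ×ˢ Finset.range n, E q) ⊆
      {ω | x < ∑ i ∈ Finset.range n, X i ω * a i ∧ y < ∑ i ∈ Finset.range n, Y i ω * a i} := by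
    refine Set.iUnion₂_subset fun q hq ω hω => ?_
    obtain ⟨hq1, hq2⟩ := Finset.mem_product.1 hq
    obtain ⟨hωA, hωB⟩ := hω
    have hbig := And.intro (hdiv hx hl hωA.1).1 (hdiv hy hl hωA.2).1
    have hsmall : ∀ k z, |z| ≤ l / ((n : ℝ) + 1) → |z * a k| ≤ l / (n + 1) := fun k z hz => by
      rw [abs_mul, abs_of_pos (ha k)]
      exact (mul_le_of_le_one_right (abs_nonneg z) (ha1 k)).trans hz
    refine ⟨lt_sum_of_one_large hq1 hl hωA.1 fun k hk hki => hsmall _ _ ?_,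
      lt_sum_of_one_large hq2 hl hωA.2 fun k hk hki => hsmall _ _ ?_⟩
    · by_contra! hc
      exact hωB ⟨hbig, Or.inl ⟨k, hk, hki, hc⟩⟩
    · by_contra! hc
      exact hωB ⟨hbig, Or.inr ⟨k, hk, hki, hc⟩⟩
  -- If two different pairs were both large, the claims of one would be a third claim above `l / (n
  -- + 1)` for the other, which the removal of `badEvent` excludes.
  have hdisj : Set.PairwiseDisjoint ↑(Finset.range n ×ˢ Finset.range n) E := by
    rintro ⟨i, j⟩ hq ⟨i', j'⟩ - hne
    obtain ⟨hi, hj⟩ := Finset.mem_product.1 (Finset.mem_coe.1 hq)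
    refine Set.disjoint_left.2 ?_
    rintro ω ⟨h1, -⟩ ⟨h2, h3⟩
    have hbig := And.intro (hdiv hx hl h2.1).1 (hdiv hy hl h2.2).1
    by_cases hii : i = i'
    · have hjj : j ≠ j' := fun hjj => hne (by rw [hii, hjj])
      exact h3 ⟨hbig, Or.inr ⟨j, hj, hjj, ((hdiv hy hl h1.2).2).trans_le (le_abs_self _)⟩⟩
    · exact h3 ⟨hbig, Or.inl ⟨i, hi, hii, ((hdiv hx hl h1.1).2).trans_le (le_abs_self _)⟩⟩
  have hmeas : ∀ q ∈ Finset.range n ×ˢ Finset.range n, MeasurableSet (E q) := fun q _ =>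
    (h.measurableSet_weighted _ _ _ _ _ _).diff (h.measurableSet_badEvent _ _ _ _ _)
  calc _ ≤ ∑ q ∈ Finset.range n ×ˢ Finset.range n, P.real (E q) :=
        Finset.sum_le_sum fun q _ => le_measureReal_sdiff
    _ = P.real (⋃ q ∈ Finset.range n ×ˢ Finset.range n, E q) :=
        (measureReal_biUnion_finset hdisj hmeas).symm
    _ ≤ _ := measureReal_mono hsub

variable [IsProbabilityMeasure F] [IsProbabilityMeasure G]

theorem mul_pos (h : FactorizingTails P X Y F G C) (u v : ℝ) : 0 < tail F u * tail G v :=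
  _root_.mul_pos (h.longTailed_left.endpoint.tail_pos u) (h.longTailed_right.endpoint.tail_pos v)

/-- This undoes both the division of levels by `n + 1` in the pigeonhole and the discounting over
`[0, T]`, at the cost of a constant factor. -/
theorem exists_scaling_bound (h : FactorizingTails P X Y F G C) :
    ∃ (K x₀ : ℝ) (q : ℕ), 0 < K ∧ 0 < x₀ ∧ ∀ n : ℕ, 1 ≤ n → ∀ x y, x₀ ≤ x → x₀ ≤ y →
      tail F (x / n) * tail G (y / n) ≤ K * n ^ q * (tail F x * tail G y) := by
  obtain ⟨K₁, x₁, q₁, hK₁, hx₁, h₁⟩ := h.dominated_left.exists_polynomial_bound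
  obtain ⟨K₂, x₂, q₂, hK₂, hx₂, h₂⟩ := h.dominated_right.exists_polynomial_bound
  refine ⟨K₁ * K₂, max x₁ x₂, q₁ + q₂, by positivity, by positivity, fun n hn x y hx hy => ?_⟩
  have h1 := h₁ n hn x ((le_max_left _ _).trans hx)
  have h2 := h₂ n hn y ((le_max_right _ _).trans hy)
  calc tail F (x / n) * tail G (y / n) ≤ (K₁ * n ^ q₁ * tail F x) * (K₂ * n ^ q₂ * tail G y) :=
        mul_le_mul h1 h2 (tail_nonneg _ _) ((tail_nonneg _ _).trans h1)
    _ = _ := by rw [pow_add]; ring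

/-- Joint tails of two weighted claims, insensitive to shifts. -/
theorem tendsto_joint_shift (h : FactorizingTails P X Y F G C) (i j : ℕ) {a b : ℝ} (ha : 0 < a)
    (ha1 : a ≤ 1) (hb : 0 < b) (hb1 : b ≤ 1) (s : ℝ) :
    Tendsto (fun p : ℝ × ℝ => (P.real {ω | p.1 + s < X i ω * a ∧ p.2 + s < Y j ω * b} -
      (if i = j then C else 1) * (tail F (p.1 / a) * tail G (p.2 / b))) /
        (tail F p.1 * tail G p.2)) minAtTop (𝓝 0) := by
  have hset : ∀ p : ℝ × ℝ, {ω | p.1 + s < X i ω * a ∧ p.2 + s < Y j ω * b} =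
      {ω | p.1 / a + s / a < X i ω ∧ p.2 / b + s / b < Y j ω} := fun p => by
    ext ω
    simp only [Set.mem_ofPred_eq, ← add_div, div_lt_iff₀ ha, div_lt_iff₀ hb]
  have hx : Tendsto (fun p : ℝ × ℝ => p.1 / a) minAtTop atTop :=
    tendsto_fst_minAtTop.atTop_div_const ha
  have hy : Tendsto (fun p : ℝ × ℝ => p.2 / b) minAtTop atTop :=
    tendsto_snd_minAtTop.atTop_div_const hb
  have h1 := (h.joint_tendsto i j).comp (Tendsto.prodMk_minAtTop
    (tendsto_atTop_add_const_right _ (s / a) hx) (tendsto_atTop_add_const_right _ (s / b) hy))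
  have h2 := ((h.longTailed_left.tendsto_add (s / a)).comp hx).mul
    ((h.longTailed_right.tendsto_add (s / b)).comp hy)
  have h3 := (h1.mul h2).sub_const (if i = j then C else 1)
  rw [mul_one, mul_one, sub_self] at h3
  refine squeeze_zero_norm' ?_ (tendsto_norm_zero.comp h3)
  filter_upwards [eventually_minAtTop_ge 0] with p hp
  have hF := h.longTailed_left.endpoint.tail_pos
  have hG := h.longTailed_right.endpoint.tail_pos
  have hR := h.mul_pos p.1 p.2
  have hle : tail F (p.1 / a) * tail G (p.2 / b) ≤ tail F p.1 * tail G p.2 :=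
    mul_le_mul (tail_antitone F (le_div_self hp.1 ha ha1))
      (tail_antitone G (le_div_self hp.2 hb hb1)) (hG _).le (hF _).le
  have e1 := (hF (p.1 / a)).ne'
  have e2 := (hG (p.2 / b)).ne'
  have e3 := (hF (p.1 / a + s / a)).ne'
  have e4 := (hG (p.2 / b + s / b)).ne'
  rw [hset]
  set J := P.real {ω | p.1 / a + s / a < X i ω ∧ p.2 / b + s / b < Y j ω} with hJ
  set w : ℝ := if i = j then C else 1
  -- The first factor tends to `0` by the joint tail asymptotics and long-tailedness. The last is at
  -- most `1`, because weights at most `1` raise the levels; so no limit of `tail F (p.1 / a) / tail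
  -- F p.1` is needed.
  have key : (J - w * (tail F (p.1 / a) * tail G (p.2 / b))) / (tail F p.1 * tail G p.2) =
      (J / (tail F (p.1 / a + s / a) * tail G (p.2 / b + s / b)) *
        (tail F (p.1 / a + s / a) / tail F (p.1 / a) *
          (tail G (p.2 / b + s / b) / tail G (p.2 / b))) - w) *
        (tail F (p.1 / a) * tail G (p.2 / b) / (tail F p.1 * tail G p.2)) := by
    clear_value J w
    generalize tail F (p.1 / a + s / a) = f₁ at e3 ⊢
    generalize tail G (p.2 / b + s / b) = g₁ at e4 ⊢
    field_simp
  rw [key, norm_mul]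
  refine mul_le_of_le_one_right (norm_nonneg _) ?_
  rw [Real.norm_of_nonneg (div_nonneg (h.mul_pos _ _).le hR.le)]
  exact (div_le_one hR).2 hle

variable [IsProbabilityMeasure P]

/-- A union bound over the third claim. The order of the quantifiers matters: `l` is fixed before
`p` goes to infinity, so that a shift by `l` remains harmless for long tails. -/
theorem eventually_badEvent_le (h : FactorizingTails P X Y F G C) (n i j : ℕ) {ε : ℝ}
    (hε : 0 < ε) : ∀ᶠ l : ℝ in atTop, ∀ᶠ p : ℝ × ℝ in minAtTop,
      P.real (badEvent X Y n i j l p) ≤ ε * (tail F p.1 * tail G p.2) := by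
  obtain ⟨K, x₀, q, hK, hx₀, hb⟩ := h.exists_scaling_bound
  have hn0 : (0 : ℝ) < n + 1 := by positivity
  set K' := K * ((n + 1 : ℕ) : ℝ) ^ q with hK'
  have hK'0 : 0 < K' := by positivity
  -- There are two unions of at most `n + 1` events each, and `K'` is the price of passing from the
  -- levels `p / (n + 1)` back to `p`.
  have hδ : 0 < ε / (K' * (2 * (n + 1))) := by positivity
  have hl : Tendsto (fun l : ℝ => l / (n + 1)) atTop atTop := tendsto_id.atTop_div_const hn0
  have hp : Tendsto (fun p : ℝ × ℝ => (p.1 / (n + 1), p.2 / (n + 1))) minAtTop minAtTop :=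
    Tendsto.prodMk_minAtTop (tendsto_fst_minAtTop.atTop_div_const hn0)
      (tendsto_snd_minAtTop.atTop_div_const hn0)
  have hX : ∀ k ∈ (Finset.range n).erase i, ∀ᶠ l : ℝ in atTop, ∀ᶠ p : ℝ × ℝ in minAtTop,
      P.real {ω | (p.1 / (n + 1) < X i ω ∧ p.2 / (n + 1) < Y j ω) ∧ l / (n + 1) < |X k ω|} ≤
        ε / (K' * (2 * (n + 1))) * (tail F (p.1 / (n + 1)) * tail G (p.2 / (n + 1))) := fun k hk =>
    (hl.eventually (h.third_left i j k (Finset.ne_of_mem_erase hk) _ hδ)).mono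
      fun l hl => hp.eventually hl
  have hY : ∀ k ∈ (Finset.range n).erase j, ∀ᶠ l : ℝ in atTop, ∀ᶠ p : ℝ × ℝ in minAtTop,
      P.real {ω | (p.1 / (n + 1) < X i ω ∧ p.2 / (n + 1) < Y j ω) ∧ l / (n + 1) < |Y k ω|} ≤
        ε / (K' * (2 * (n + 1))) * (tail F (p.1 / (n + 1)) * tail G (p.2 / (n + 1))) := fun k hk =>
    (hl.eventually (h.third_right i j k (Finset.ne_of_mem_erase hk) _ hδ)).mono
      fun l hl => hp.eventually hl
  filter_upwards [(Filter.eventually_all_finset _).2 hX, (Filter.eventually_all_finset _).2 hY]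
    with l hXl hYl
  filter_upwards [(Filter.eventually_all_finset _).2 hXl, (Filter.eventually_all_finset _).2 hYl,
    eventually_minAtTop_ge x₀] with p hXp hYp hp0
  have hsub : badEvent X Y n i j l p ⊆
      (⋃ k ∈ (Finset.range n).erase i,
        {ω | (p.1 / (n + 1) < X i ω ∧ p.2 / (n + 1) < Y j ω) ∧ l / (n + 1) < |X k ω|}) ∪
      ⋃ k ∈ (Finset.range n).erase j,
        {ω | (p.1 / (n + 1) < X i ω ∧ p.2 / (n + 1) < Y j ω) ∧ l / (n + 1) < |Y k ω|} := by
    rintro ω ⟨hω, ⟨k, hk, hki, hlk⟩ | ⟨k, hk, hki, hlk⟩⟩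
    · exact Or.inl (Set.mem_biUnion (Finset.mem_coe.2 (Finset.mem_erase.2 ⟨hki, hk⟩)) ⟨hω, hlk⟩)
    · exact Or.inr (Set.mem_biUnion (Finset.mem_coe.2 (Finset.mem_erase.2 ⟨hki, hk⟩)) ⟨hω, hlk⟩)
  set R' := tail F (p.1 / (n + 1)) * tail G (p.2 / (n + 1)) with hR'
  have hR'0 : 0 < R' := h.mul_pos _ _
  have hR : R' ≤ K' * (tail F p.1 * tail G p.2) := by
    simpa [hR', hK'] using hb (n + 1) (by omega) p.1 p.2 hp0.1 hp0.2
  have hcard : ∀ m, (((Finset.range n).erase m).card : ℝ) ≤ n + 1 := fun m => by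
    have := (Finset.card_erase_le (s := Finset.range n) (a := m)).trans (Finset.card_range n).le
    exact_mod_cast this.trans (Nat.le_succ n)
  have hsum : ∀ (m : ℕ) (A : ℕ → Set Ω), (∀ k ∈ (Finset.range n).erase m,
      P.real (A k) ≤ ε / (K' * (2 * (n + 1))) * R') →
      P.real (⋃ k ∈ (Finset.range n).erase m, A k) ≤ ε / (2 * K') * R' := fun m A hA => by
    refine (measureReal_biUnion_finset_le _ _).trans ((Finset.sum_le_card_nsmul _ _ _ hA).trans ?_)
    rw [nsmul_eq_mul]
    calc _ ≤ ((n : ℝ) + 1) * (ε / (K' * (2 * (n + 1))) * R') := by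
          gcongr; exact hcard m
      _ = ε / (2 * K') * R' := by field_simp
  calc P.real (badEvent X Y n i j l p) ≤ ε / (2 * K') * R' + ε / (2 * K') * R' :=
        (measureReal_mono hsub).trans ((measureReal_union_le _ _).trans
          (add_le_add (hsum i _ hXp) (hsum j _ hYp)))
    _ = ε / K' * R' := by field_simp; ring
    _ ≤ ε / K' * (K' * (tail F p.1 * tail G p.2)) := by gcongr
    _ = ε * (tail F p.1 * tail G p.2) := by field_simp

variable {a : ℕ → ℝ}

/-- The joint tail of finite weighted sums is asymptotically the sum of the joint tails. -/
theorem tendsto_sum_tail (h : FactorizingTails P X Y F G C) (ha : ∀ i, 0 < a i)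
    (ha1 : ∀ i, a i ≤ 1) (n : ℕ) :
    Tendsto (fun p : ℝ × ℝ =>
      (P.real {ω | p.1 < ∑ i ∈ Finset.range n, X i ω * a i ∧
          p.2 < ∑ i ∈ Finset.range n, Y i ω * a i} -
        ∑ q ∈ Finset.range n ×ˢ Finset.range n, (if q.1 = q.2 then C else 1) *
          (tail F (p.1 / a q.1) * tail G (p.2 / a q.2))) / (tail F p.1 * tail G p.2))
      minAtTop (𝓝 0) := by
  rw [Metric.tendsto_nhds]
  intro ε hε
  set s := Finset.range n ×ˢ Finset.range n
  -- Each pair costs `δ` for its bad event and `δ` for the shift; the `+ 1` makes the total strictly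
  -- less than `ε`.
  set δ := ε / (2 * (s.card + 1)) with hδ
  have hδ0 : 0 < δ := by positivity
  have hbad : ∀ᶠ l : ℝ in atTop, ∀ q ∈ s, ∀ᶠ p : ℝ × ℝ in minAtTop,
      P.real (badEvent X Y n q.1 q.2 l p) ≤ δ * (tail F p.1 * tail G p.2) :=
    (Filter.eventually_all_finset _).2 fun q _ => h.eventually_badEvent_le n q.1 q.2 hδ0
  obtain ⟨l, hl, hl0⟩ := (hbad.and (eventually_gt_atTop 0)).exists
  have hshift : ∀ t : ℝ, ∀ᶠ p : ℝ × ℝ in minAtTop, ∀ q ∈ s,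
      |P.real {ω | p.1 + t < X q.1 ω * a q.1 ∧ p.2 + t < Y q.2 ω * a q.2} -
        (if q.1 = q.2 then C else 1) * (tail F (p.1 / a q.1) * tail G (p.2 / a q.2))| ≤
      δ * (tail F p.1 * tail G p.2) := fun t =>
    (Filter.eventually_all_finset _).2 fun q _ => by
      filter_upwards [Metric.tendsto_nhds.1 (h.tendsto_joint_shift q.1 q.2 (ha q.1) (ha1 q.1)
        (ha q.2) (ha1 q.2) t) δ hδ0] with p hp
      have hR := h.mul_pos p.1 p.2
      rw [Real.dist_eq, sub_zero, abs_div, abs_of_pos hR, div_lt_iff₀ hR] at hp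
      exact hp.le
  filter_upwards [(Filter.eventually_all_finset _).2 hl, hshift (-l), hshift l,
    eventually_minAtTop_ge 1] with p hp1 hp2 hp3 hp4
  have hx : 0 < p.1 := by linarith [hp4.1]
  have hy : 0 < p.2 := by linarith [hp4.2]
  have hR := h.mul_pos p.1 p.2
  have hup := sum_tail_le (P := P) (X := X) (Y := Y) ha ha1 n hx hy hl0
  have hlo := h.le_sum_tail ha ha1 n hx hy hl0
  rw [Real.dist_eq, sub_zero, abs_div, abs_of_pos hR, div_lt_iff₀ hR]
  have hsum : ∑ _q ∈ s, (2 * (δ * (tail F p.1 * tail G p.2))) < ε * (tail F p.1 * tail G p.2) := by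
    rw [Finset.sum_const, nsmul_eq_mul]
    have : s.card * (2 * δ) < ε := by
      rw [hδ, show (s.card : ℝ) * (2 * (ε / (2 * (s.card + 1)))) = s.card * ε / (s.card + 1) by
        field_simp, div_lt_iff₀ (by positivity)]
      nlinarith
    nlinarith
  refine lt_of_le_of_lt (abs_le.2 ⟨?_, ?_⟩) hsum
  · refine le_trans ?_ (sub_le_sub_right hlo _)
    rw [← Finset.sum_neg_distrib, ← Finset.sum_sub_distrib]
    refine Finset.sum_le_sum fun q hq => ?_
    linarith [hp1 q hq, (abs_le.1 (hp3 q hq)).1]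
  · refine (sub_le_sub_right hup _).trans ?_
    rw [← Finset.sum_sub_distrib]
    refine Finset.sum_le_sum fun q hq => ?_
    linarith [hp1 q hq, (abs_le.1 (hp2 q hq)).2]

/-- Kesten-type bound for the joint tail of weighted sums, polynomial in the number of terms. -/
theorem exists_sum_tail_bound (h : FactorizingTails P X Y F G C) :
    ∃ (K x₀ : ℝ) (q : ℕ), 0 < K ∧ 0 < x₀ ∧ ∀ (a : ℕ → ℝ), (∀ i, 0 < a i) → (∀ i, a i ≤ 1) →
      ∀ (n : ℕ) (p : ℝ × ℝ), x₀ ≤ p.1 → x₀ ≤ p.2 →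
        P.real {ω | p.1 < ∑ i ∈ Finset.range n, X i ω * a i ∧
          p.2 < ∑ i ∈ Finset.range n, Y i ω * a i} ≤
          K * (n + 1) ^ q * (tail F p.1 * tail G p.2) := by
  obtain ⟨K, x₀, q, hK, hx₀, hb⟩ := h.exists_scaling_bound
  obtain ⟨B, hB, hJ⟩ := h.joint_le
  -- The two extra powers count the `n ^ 2` pairs given by the pigeonhole.
  refine ⟨B * K, x₀, q + 2, by positivity, hx₀, fun a ha ha1 n p hpx hpy => ?_⟩
  have hx : 0 < p.1 := hx₀.trans_le hpx
  have hy : 0 < p.2 := hx₀.trans_le hpy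
  have hn : (0 : ℝ) < n + 1 := by positivity
  have hle : ∀ {i : ℕ} {z u : ℝ}, 0 < u → u < z * a i → u < z := fun {i z u} hu hz => by
    have hz0 : 0 < z := pos_of_mul_pos_left (hu.trans hz) (ha i).le
    exact hz.trans_le (mul_le_of_le_one_right hz0.le (ha1 i))
  have hsub : {ω | p.1 < ∑ i ∈ Finset.range n, X i ω * a i ∧
      p.2 < ∑ i ∈ Finset.range n, Y i ω * a i} ⊆ ⋃ q ∈ Finset.range n ×ˢ Finset.range n,
        {ω | p.1 / (n + 1) < X q.1 ω ∧ p.2 / (n + 1) < Y q.2 ω} := by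
    rintro ω ⟨hωx, hωy⟩
    obtain ⟨i, hi, hxi⟩ := exists_lt_of_lt_sum (Finset.card_range n).le hx hωx
    obtain ⟨j, hj, hyj⟩ := exists_lt_of_lt_sum (Finset.card_range n).le hy hωy
    exact Set.mem_biUnion (x := (i, j)) (Finset.mem_coe.2 (Finset.mk_mem_product hi hj))
      ⟨hle (div_pos hx hn) hxi, hle (div_pos hy hn) hyj⟩
  have hterm : ∀ m ∈ Finset.range n ×ˢ Finset.range n,
      P.real {ω | p.1 / (n + 1) < X m.1 ω ∧ p.2 / (n + 1) < Y m.2 ω} ≤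
        B * (K * (n + 1) ^ q * (tail F p.1 * tail G p.2)) := fun m _ => by
    refine (hJ m.1 m.2 _ _).trans (mul_le_mul_of_nonneg_left ?_ hB.le)
    simpa using hb (n + 1) (by omega) p.1 p.2 hpx hpy
  have hR := h.mul_pos p.1 p.2
  refine (measureReal_mono hsub (measure_ne_top _ _)).trans
    ((measureReal_biUnion_finset_le _ _).trans
    ((Finset.sum_le_card_nsmul _ _ _ hterm).trans ?_))
  rw [nsmul_eq_mul, Finset.card_product, Finset.card_range, Nat.cast_mul]
  have hnn : (n : ℝ) * n ≤ (n + 1) ^ 2 := by nlinarith [(Nat.cast_nonneg n : (0 : ℝ) ≤ n)]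
  calc _ ≤ ((n : ℝ) + 1) ^ 2 * (B * (K * (n + 1) ^ q * (tail F p.1 * tail G p.2))) := by gcongr
    _ = _ := by rw [pow_add]; ring

end FactorizingTails

/-! ### The hypotheses of the risk model -/

/-- Off the diagonal the joint tail is an exact product, on it SAI gives the limit `C`. The bounds
on third claims are the GTAI conditional probabilities multiplied by the joint tail of the
conditioning pair. -/
theorem IsGTAI.factorizingTails {P : Measure Ω} [IsProbabilityMeasure P] {X Y : ℕ → Ω → ℝ}
    {C : ℝ} (hX : ∀ i, Measurable (X i)) (hY : ∀ i, Measurable (Y i))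
    (hident : ∀ i, IdentDistrib (fun ω => (X i ω, Y i ω)) (fun ω => (X 0 ω, Y 0 ω)) P P)
    (hFL : LongTailed (P.map (X 0))) (hFD : DominatedlyVarying (P.map (X 0)))
    (hGL : LongTailed (P.map (Y 0))) (hGD : DominatedlyVarying (P.map (Y 0)))
    (hGTAI : ∀ n m : ℕ, IsGTAI P (fun i : Fin n => X i) (fun j : Fin m => Y j))
    (hSAI : ∀ i, IsSAI P (X i) (Y i) C) (hXY : ∀ i j, i ≠ j → IndepFun (X i) (Y j) P) :
    FactorizingTails P X Y (P.map (X 0)) (P.map (Y 0)) C := by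
  have : IsProbabilityMeasure (P.map (X 0)) := Measure.isProbabilityMeasure_map (hX 0).aemeasurable
  have : IsProbabilityMeasure (P.map (Y 0)) := Measure.isProbabilityMeasure_map (hY 0).aemeasurable
  have hXi : ∀ i, P.map (X i) = P.map (X 0) := fun i =>
    ((hident i).comp measurable_fst).map_eq
  have hYi : ∀ i, P.map (Y i) = P.map (Y 0) := fun i =>
    ((hident i).comp measurable_snd).map_eq
  have hPX : ∀ i u, P.real {ω | u < X i ω} = tail (P.map (X 0)) u := fun i u => by
    rw [← tail_map P (hX i), hXi]
  have hPY : ∀ i u, P.real {ω | u < Y i ω} = tail (P.map (Y 0)) u := fun i u => by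
    rw [← tail_map P (hY i), hYi]
  set F := P.map (X 0)
  set G := P.map (Y 0)
  have hF := hFL.endpoint.tail_pos
  have hG := hGL.endpoint.tail_pos
  have hoff : ∀ i j, i ≠ j → ∀ u v,
      P.real {ω | u < X i ω ∧ v < Y j ω} = tail F u * tail G v := fun i j hij u v => by
    rw [← hPX i, ← hPY j]
    simp only [measureReal_def]
    rw [← ENNReal.toReal_mul]
    congr 1
    exact (hXY i j hij).measure_inter_preimage_eq_mul _ _ measurableSet_Ioi measurableSet_Ioi
  have hdiag : ∀ i u v, P.real {ω | u < X i ω ∧ v < Y i ω} =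
      P.real {ω | u < X 0 ω ∧ v < Y 0 ω} := fun i u v => by
    simp only [measureReal_def]
    congr 1
    exact (hident i).measure_mem_eq (measurableSet_Ioi.prod measurableSet_Ioi :
      MeasurableSet (Set.Ioi u ×ˢ Set.Ioi v))
  have hlim : ∀ i, Tendsto (fun p : ℝ × ℝ =>
      P.real {ω | p.1 < X i ω ∧ p.2 < Y i ω} / (tail F p.1 * tail G p.2)) minAtTop (𝓝 C) :=
    fun i => by simpa only [hXi, hYi] using (hSAI i).tendsto_const
  have hjoint : ∃ B, 0 < B ∧ ∀ i j u v,
      P.real {ω | u < X i ω ∧ v < Y j ω} ≤ B * (tail F u * tail G v) := by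
    have hev := (hlim 0).eventually (eventually_le_nhds (lt_add_one C))
    rw [minAtTop_eq_prod, prod_atTop_atTop_eq, eventually_atTop] at hev
    obtain ⟨⟨m₁, m₂⟩, hm⟩ := hev
    have hC := (hSAI 0).pos
    -- SAI gives the bound `C + 1` only beyond `(m₁, m₂)`. If one level lies below its threshold,
    -- that tail is bounded below, and the joint probability is at most the other marginal tail.
    refine ⟨(C + 1) + (tail F m₁)⁻¹ + (tail G m₂)⁻¹, ?_, fun i j u v => ?_⟩
    · have := hF m₁
      have := hG m₂
      positivity
    have h1 := inv_pos.2 (hF m₁)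
    have h2 := inv_pos.2 (hG m₂)
    have hu := hF u
    have hv := hG v
    have huv : 0 < tail F u * tail G v := mul_pos hu hv
    rcases eq_or_ne i j with rfl | hij
    · rw [add_mul, add_mul]
      by_cases hum : m₁ ≤ u
      · by_cases hvm : m₂ ≤ v
        · have := (div_le_iff₀ huv).1 (hm (u, v) ⟨hum, hvm⟩)
          rw [hdiag]
          simp only at this
          nlinarith [mul_pos h1 huv, mul_pos h2 huv]
        · have h3 : 1 ≤ (tail G m₂)⁻¹ * tail G v := by
            rw [inv_mul_eq_div, one_le_div (hG m₂)]
            exact tail_antitone G (not_le.1 hvm).le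
          have h4 : P.real {ω | u < X i ω ∧ v < Y i ω} ≤ tail F u := by
            rw [← hPX i]; exact measureReal_mono fun ω hω => hω.1
          nlinarith [mul_pos h1 huv, mul_pos hC huv, mul_le_mul_of_nonneg_left h3 hu.le]
      · have h3 : 1 ≤ (tail F m₁)⁻¹ * tail F u := by
          rw [inv_mul_eq_div, one_le_div (hF m₁)]
          exact tail_antitone F (not_le.1 hum).le
        have h4 : P.real {ω | u < X i ω ∧ v < Y i ω} ≤ tail G v := by
          rw [← hPY i]; exact measureReal_mono fun ω hω => hω.2
        nlinarith [mul_pos h2 huv, mul_pos hC huv, mul_le_mul_of_nonneg_left h3 hv.le]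
    · rw [hoff i j hij]
      nlinarith [mul_pos h1 huv, mul_pos h2 huv, mul_pos hC huv]
  obtain ⟨B, hB, hJ⟩ := hjoint
  have hthird : ∀ (i j : ℕ) (Z : Ω → ℝ), Tendsto (fun p : ℝ × ℝ × ℝ =>
      (P[|{ω | p.2.1 < X i ω ∧ p.2.2 < Y j ω}]).real {ω | p.1 < |Z ω|}) minAtTop₃ (𝓝 0) →
      ∀ ε > 0, ∀ᶠ l : ℝ in atTop, ∀ᶠ p : ℝ × ℝ in minAtTop,
        P.real {ω | (p.1 < X i ω ∧ p.2 < Y j ω) ∧ l < |Z ω|} ≤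
          ε * (tail F p.1 * tail G p.2) := fun i j Z hZ ε hε => by
    have hev := hZ.eventually (eventually_le_nhds (div_pos hε hB))
    rw [minAtTop₃_eq_prod, ← minAtTop_eq_prod] at hev
    -- As `minAtTop₃` is a product filter, the limit in three variables yields the iterated one,
    -- first `l` and then `p`.
    refine hev.curry.mono fun l hl => hl.mono fun p hp => ?_
    have hmeas : MeasurableSet {ω | p.1 < X i ω ∧ p.2 < Y j ω} :=
      (measurableSet_lt measurable_const (hX i)).inter (measurableSet_lt measurable_const (hY j))
    have heq : P.real {ω | (p.1 < X i ω ∧ p.2 < Y j ω) ∧ l < |Z ω|} =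
        (P[|{ω | p.1 < X i ω ∧ p.2 < Y j ω}]).real {ω | l < |Z ω|} *
          P.real {ω | p.1 < X i ω ∧ p.2 < Y j ω} := by
      simp only [measureReal_def]
      rw [← ENNReal.toReal_mul, cond_mul_eq_inter hmeas]
      rfl
    rw [heq]
    calc _ ≤ ε / B * (B * (tail F p.1 * tail G p.2)) :=
          mul_le_mul hp (hJ i j _ _) measureReal_nonneg (div_pos hε hB).le
      _ = _ := by field_simp
  refine ⟨hX, hY, hFL, hGL, hFD, hGD, ⟨B, hB, hJ⟩, fun i j => ?_, fun i j k hki => ?_,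
    fun i j k hkj => ?_⟩
  · split_ifs with hij
    · subst hij
      exact hlim i
    · refine tendsto_const_nhds.congr fun p => ?_
      rw [hoff i j hij, div_self (mul_pos (hF _) (hG _)).ne']
  · exact hthird i j (X k) ((hGTAI (max i k + 1) (j + 1)).left ⟨k, by omega⟩ ⟨i, by omega⟩
      ⟨j, by omega⟩ (by simpa using hki.symm))
  · exact hthird i j (Y k) ((hGTAI (i + 1) (max j k + 1)).right ⟨k, by omega⟩ ⟨j, by omega⟩
      ⟨i, by omega⟩ (by simpa using hkj))

end

section
variable {Ω : Type*} [MeasurableSpace Ω]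

/-! ### Measurability of the counting process -/

theorem measurable_arrival {θ : ℕ → Ω → ℝ} (hθ : ∀ i, Measurable (θ i)) (i : ℕ) :
    Measurable (arrival θ i) :=
  Finset.measurable_fun_sum _ fun k _ => hθ k

theorem measurable_counting_toNat {θ : ℕ → Ω → ℝ} (hθ : ∀ i, Measurable (θ i)) (t : ℝ) :
    Measurable fun ω => (counting θ t ω).toNat := by
  have hs : ∀ i, MeasurableSet {ω | arrival θ i ω ≤ t} := fun i =>
    measurableSet_le (measurable_arrival hθ i) measurable_const
  have key : ∀ ω, (counting θ t ω : ENNReal) =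
      ∑' i : ℕ, Set.indicator {ω | arrival θ i ω ≤ t} (fun _ => (1 : ENNReal)) ω := fun ω => by
    rw [counting, ← ENNReal.tsum_set_one, tsum_subtype {i : ℕ | arrival θ i ω ≤ t} fun _ => 1]
    rfl
  -- Both `toNat` and `toReal` send infinity to `0`, so finiteness of the count is not needed.
  have hfloor : ∀ m : ℕ∞, m.toNat = ⌊(m : ENNReal).toReal⌋₊ := fun m => by
    induction m using ENat.recTopCoe <;> simp
  simp only [hfloor, key]
  exact Nat.measurable_floor.comp (Measurable.tsum fun i =>
    measurable_const.indicator (hs i)).ennreal_toReal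

theorem measurable_apply_nat {β : Type*} [MeasurableSpace β] {N : Ω → ℕ} (hN : Measurable N)
    {f : ℕ → Ω → β} (hf : ∀ n, Measurable (f n)) : Measurable fun ω => f (N ω) ω :=
  (measurable_from_prod_countable_right (f := fun q : ℕ × Ω => f q.1 q.2) hf).comp
    (hN.prodMk measurable_id)

theorem measurable_discountedClaims (r : ℝ) {θ Z : ℕ → Ω → ℝ} (hθ : ∀ i, Measurable (θ i))
    (hZ : ∀ i, Measurable (Z i)) (t : ℝ) : Measurable (discountedClaims r θ Z t) := by
  refine measurable_apply_nat (measurable_counting_toNat hθ t)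
    (f := fun n ω => ∑ i ∈ Finset.range n, Z i ω * Real.exp (-r * arrival θ i ω)) fun n => ?_
  exact Finset.measurable_fun_sum _ fun i _ =>
    (hZ i).mul ((measurable_arrival hθ i).const_mul _).exp

namespace IsRenewal

variable {P : Measure Ω} {θ : ℕ → Ω → ℝ}

theorem ae_pos (h : IsRenewal P θ) : ∀ᵐ ω ∂P, ∀ i, 0 < θ i ω := ae_all_iff.2 h.pos

variable [IsProbabilityMeasure P]

/-! ### Moments of the counting process -/

/-- Chernoff's bound with parameter `-1`: `P(T_i ≤ t) ≤ e^t (E e^{-θ})^i` for the `i`-th arrival,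
where `E e^{-θ} < 1` because `θ > 0` almost surely. -/
theorem exists_geometric_bound (h : IsRenewal P θ) (t : ℝ) : ∃ A ρ : ℝ, 0 < A ∧ 0 < ρ ∧ ρ < 1 ∧
    ∀ i, P.real {ω | arrival θ i ω ≤ t} ≤ A * ρ ^ (i + 1) := by
  have hint : ∀ i, Integrable (fun ω => Real.exp (-1 * θ i ω)) P := fun i => by
    refine Integrable.of_bound ((h.measurable i).const_mul _).exp.aestronglyMeasurable 1 ?_
    filter_upwards [h.pos i] with ω hω
    rw [Real.norm_of_nonneg (Real.exp_pos _).le, Real.exp_le_one_iff]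
    linarith
  refine ⟨Real.exp t, mgf (θ 0) P (-1), Real.exp_pos _, mgf_pos (hint 0), ?_, fun i => ?_⟩
  · have h1 : 0 ≤ᵐ[P] fun ω => 1 - Real.exp (-1 * θ 0 ω) := by
      filter_upwards [h.pos 0] with ω hω
      have : Real.exp (-1 * θ 0 ω) ≤ 1 := Real.exp_le_one_iff.2 (by linarith)
      simpa using this
    have h2 : ∫ ω, (1 - Real.exp (-1 * θ 0 ω)) ∂P = 1 - mgf (θ 0) P (-1) := by
      rw [integral_sub (integrable_const _) (hint 0)]
      simp [mgf]
    have h3 : 0 < ∫ ω, (1 - Real.exp (-1 * θ 0 ω)) ∂P := by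
      refine (integral_nonneg_of_ae h1).lt_of_ne' fun h0 => ?_
      rw [integral_eq_zero_iff_of_nonneg_ae h1 ((integrable_const _).sub (hint 0))] at h0
      obtain ⟨ω, hω1, hω2⟩ := (h0.and (h.pos 0)).exists
      have : Real.exp (-1 * θ 0 ω) < 1 := Real.exp_lt_one_iff.2 (by linarith)
      simp only [Pi.zero_apply] at hω1
      linarith
    linarith
  · have hsum : (fun ω => arrival θ i ω) = ∑ k ∈ Finset.range (i + 1), θ k := by
      ext ω; simp [arrival]
    have hb := measure_le_le_exp_mul_mgf (μ := P) (X := ∑ k ∈ Finset.range (i + 1), θ k) t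
      (by norm_num : (-1 : ℝ) ≤ 0)
      (h.indep.integrable_exp_mul_sum h.measurable fun i _ => hint i)
    rw [mgf_sum_of_identDistrib (j := 0) h.measurable h.indep
      (fun i _ j _ => (h.ident i).trans (h.ident j).symm) (by simp), Finset.card_range,
      ← hsum] at hb
    simpa using hb

theorem summable_pow_mul_arrival (h : IsRenewal P θ) (t : ℝ) (q : ℕ) :
    Summable fun i : ℕ => ((i : ℝ) + 2) ^ q * P.real {ω | arrival θ i ω ≤ t} := by
  obtain ⟨A, ρ, hA, hρ, hρ1, hb⟩ := h.exists_geometric_bound t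
  have hs := summable_pow_mul_geometric_of_norm_lt_one q
    (show ‖ρ‖ < 1 by rwa [Real.norm_of_nonneg hρ.le])
  have hs2 := ((summable_nat_add_iff 2).2 hs).mul_left (A / ρ)
  refine Summable.of_nonneg_of_le (fun i => by positivity) (fun i => ?_) hs2
  calc ((i : ℝ) + 2) ^ q * P.real {ω | arrival θ i ω ≤ t}
      ≤ ((i : ℝ) + 2) ^ q * (A * ρ ^ (i + 1)) := by gcongr; exact hb i
    _ = A / ρ * (((i + 2 : ℕ) : ℝ) ^ q * ρ ^ (i + 2)) := by
      push_cast; field_simp; ring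

theorem tsum_pow_mul_arrival_ne_top (h : IsRenewal P θ) (t : ℝ) (q : ℕ) :
    ∑' i : ℕ, ENNReal.ofReal (((i : ℝ) + 2) ^ q) * P {ω | arrival θ i ω ≤ t} ≠ ⊤ := by
  have := (h.summable_pow_mul_arrival t q).tsum_ofReal_ne_top
  refine ne_of_eq_of_ne (tsum_congr fun i => ?_) this
  rw [ENNReal.ofReal_mul (by positivity), ofReal_measureReal]

/-- Almost surely, the counting process is finite and counts an initial segment of arrivals. -/
theorem ae_counting (h : IsRenewal P θ) (t : ℝ) : ∀ᵐ ω ∂P,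
    counting θ t ω = (counting θ t ω).toNat ∧
      ∀ i, i < (counting θ t ω).toNat ↔ arrival θ i ω ≤ t := by
  -- Borel–Cantelli, from the summability with exponent `0`.
  have hfin : ∀ᵐ ω ∂P, {i | ω ∈ {ω | arrival θ i ω ≤ t}}.Finite :=
    ae_finite_setOfPred_mem (by simpa using h.tsum_pow_mul_arrival_ne_top t 0)
  filter_upwards [hfin, h.ae_pos] with ω hω hpos
  have hmono : ∀ i j, i ≤ j → arrival θ i ω ≤ arrival θ j ω := fun i j hij =>
    Finset.sum_le_sum_of_subset_of_nonneg (Finset.range_mono (by omega))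
      fun k _ _ => (hpos k).le
  set A := {i | arrival θ i ω ≤ t} with hA
  have hAfin : A.Finite := hω
  have hex : ∃ n, n ∉ A := hAfin.exists_notMem
  classical
  have hIio : A = Set.Iio (Nat.find hex) := by
    ext i
    refine ⟨fun hi => ?_, fun hi => ?_⟩
    · by_contra hc
      exact Nat.find_spec hex ((hmono _ _ (not_lt.1 hc)).trans hi)
    · exact not_not.1 (Nat.find_min hex hi)
  have hcount : counting θ t ω = (Nat.find hex : ℕ) := by
    have h1 : counting θ t ω = A.encard := rfl
    have h2 := congrArg Set.encard hIio
    rw [← Finset.coe_range, Set.encard_coe_eq_coe_finsetCard, Finset.card_range] at h2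
    exact h1.trans h2
  rw [hcount]
  refine ⟨by simp, fun i => ?_⟩
  have : i ∈ A ↔ i ∈ Set.Iio (Nat.find hex) := by rw [← hIio]
  simpa [hA] using this.symm

/-- The counting process of a renewal sequence has moments of all orders. -/
theorem integrable_counting_pow (h : IsRenewal P θ) (t : ℝ) (q : ℕ) :
    Integrable (fun ω => (((counting θ t ω).toNat : ℝ) + 1) ^ q) P := by
  have hN := measurable_counting_toNat h.measurable t
  have hmeas : Measurable fun ω => (((counting θ t ω).toNat : ℝ) + 1) ^ q :=
    measurable_apply_nat hN (f := fun n _ => ((n : ℝ) + 1) ^ q) fun n => measurable_const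
  have hs : ∀ i, MeasurableSet {ω | arrival θ i ω ≤ t} := fun i =>
    measurableSet_le (measurable_arrival h.measurable i) measurable_const
  refine ⟨hmeas.aestronglyMeasurable, ?_⟩
  rw [hasFiniteIntegral_iff_ofReal (Eventually.of_forall fun ω => by positivity)]
  -- For `N ≥ 1` the last arrival has index `i = N - 1`, and `(N + 1) ^ q` is the single term `(i +
  -- 2) ^ q`; the summand `1` covers `N = 0`.
  have hle : ∀ᵐ ω ∂P, ENNReal.ofReal ((((counting θ t ω).toNat : ℝ) + 1) ^ q) ≤
      1 + ∑' i : ℕ, Set.indicator {ω | arrival θ i ω ≤ t}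
        (fun _ => ENNReal.ofReal (((i : ℝ) + 2) ^ q)) ω := by
    filter_upwards [h.ae_counting t] with ω hω
    rcases Nat.eq_zero_or_eq_succ_pred (counting θ t ω).toNat with h0 | h0
    · rw [h0]; simp
    · refine le_add_left ((le_of_eq ?_).trans
        (ENNReal.le_tsum ((counting θ t ω).toNat.pred)))
      have hmem : ω ∈ {ω' | arrival θ ((counting θ t ω).toNat.pred) ω' ≤ t} :=
        (hω.2 _).1 (by omega)
      rw [Set.indicator_of_mem hmem]
      have h0' : ((counting θ t ω).toNat : ℝ) = ((counting θ t ω).toNat.pred : ℝ) + 1 := by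
        exact_mod_cast h0
      rw [h0']
      ring_nf
  refine (lintegral_mono_ae hle).trans_lt ?_
  rw [lintegral_add_left measurable_const, lintegral_tsum fun i =>
    (measurable_const.indicator (hs i)).aemeasurable]
  simp only [lintegral_indicator (hs _), lintegral_const, Measure.restrict_apply_univ]
  simpa using (h.tsum_pow_mul_arrival_ne_top t q).lt_top

/-! ### The renewal measure -/

/-- An arrival time and the time elapsed between it and a later arrival time are independent,
and the latter is distributed as an arrival time. -/
theorem map_arrival_increment (h : IsRenewal P θ) (i j : ℕ) :
    P.map (fun ω => (arrival θ (j + i + 1) ω - arrival θ j ω, arrival θ j ω)) =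
      (P.map (arrival θ i)).prod (P.map (arrival θ j)) := by
  -- From index `j` to `j + i + 1` there are `i + 1` inter-arrival times, as many as in `arrival θ
  -- i`.
  have hinc : ∀ ω, arrival θ (j + i + 1) ω - arrival θ j ω =
      ∑ k ∈ Finset.range (i + 1), θ (j + 1 + k) ω := fun ω => by
    rw [arrival, arrival, show j + i + 1 + 1 = (j + 1) + (i + 1) by ring, Finset.sum_range_add]
    ring
  have hmap : P.map (fun ω => ∑ k ∈ Finset.range (i + 1), θ (j + 1 + k) ω) =
      P.map (arrival θ i) := by
    have hid : IdentDistrib (fun ω k => θ (j + 1 + k) ω) (fun ω k => θ k ω) P P :=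
      IdentDistrib.pi (fun k => (h.ident _).trans (h.ident k).symm)
        (h.indep.precomp (add_right_injective (j + 1))) h.indep
    exact (hid.comp (u := fun v : ℕ → ℝ => ∑ k ∈ Finset.range (i + 1), v k)
      (Finset.measurable_fun_sum _ fun k _ => measurable_pi_apply k)).map_eq
  have hind : IndepFun (fun ω => ∑ k ∈ Finset.range (i + 1), θ (j + 1 + k) ω) (arrival θ j) P := by
    have hdisj : Disjoint (Finset.Ico (j + 1) (j + 1 + (i + 1))) (Finset.range (j + 1)) := by
      rw [Finset.range_eq_Ico, disjoint_comm]
      exact Finset.Ico_disjoint_Ico_consecutive 0 (j + 1) _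
    have hI := (h.indep.indepFun_finset _ _ hdisj h.measurable).comp
      (φ := fun v => ∑ k, v k) (ψ := fun v => ∑ k, v k)
      (Finset.measurable_fun_sum _ fun k _ => measurable_pi_apply k)
      (Finset.measurable_fun_sum _ fun k _ => measurable_pi_apply k)
    refine hI.congr (ae_of_all _ fun ω => ?_) (ae_of_all _ fun ω => ?_)
    · simp only [Function.comp]
      rw [Finset.sum_coe_sort (Finset.Ico (j + 1) (j + 1 + (i + 1))) (fun k => θ k ω),
        Finset.sum_Ico_eq_sum_range]
      simp
    · simp only [Function.comp]
      rw [Finset.sum_coe_sort (Finset.range (j + 1)) (fun k => θ k ω), arrival]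
  have hm1 : Measurable fun ω => ∑ k ∈ Finset.range (i + 1), θ (j + 1 + k) ω :=
    Finset.measurable_fun_sum _ fun k _ => h.measurable _
  simp only [hinc]
  rw [hind.map_prod_eq_prod_map_map hm1.aemeasurable
    (measurable_arrival h.measurable j).aemeasurable, hmap]

end IsRenewal

/-- Splitting a double series into the part off the diagonal and the diagonal. -/
theorem tsum_tsum_eq_offDiag_add_diag (U : ℕ → ℕ → ENNReal) :
    ∑' i, ∑' j, U i j =
      (∑' i, ∑' j, (U (j + i + 1) j + U j (j + i + 1))) + ∑' i, U i i := by
  have hhalf : ∀ V : ℕ → ℕ → ENNReal,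
      ∑' i, ∑' j, (if i < j then V i j else 0) = ∑' i, ∑' j, V j (j + i + 1) := fun V => by
    rw [ENNReal.tsum_comm (f := fun i j => V j (j + i + 1))]
    refine tsum_congr fun i => ?_
    have hinj : Function.Injective fun k : ℕ => i + k + 1 := fun a b hab => by
      simp only at hab; omega
    have := hinj.tsum_eq (f := fun j => if i < j then V i j else 0) fun j hj => by
      have hij : i < j := by
        by_contra hc
        simp [hc] at hj
      exact ⟨j - i - 1, by simp only; omega⟩
    rw [← this]
    refine tsum_congr fun k => ?_
    rw [if_pos (by omega)]
  have hsplit : ∀ i j, U i j = (if j < i then U i j else 0) + (if i < j then U i j else 0) +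
      if j = i then U i j else 0 := fun i j => by
    rcases lt_trichotomy i j with hij | rfl | hij
    · simp [hij, hij.not_gt, hij.ne']
    · simp
    · simp [hij, hij.not_gt, hij.ne]
  have h1 := hhalf U
  have h2 := hhalf fun i j => U j i
  rw [ENNReal.tsum_comm] at h2
  calc ∑' i, ∑' j, U i j = ∑' i, ∑' j, ((if j < i then U i j else 0) +
        (if i < j then U i j else 0) + if j = i then U i j else 0) :=
        tsum_congr fun i => tsum_congr fun j => hsplit i j
    _ = _ := by
      simp only [ENNReal.tsum_add, tsum_ite_eq]
      rw [h1, h2]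

namespace IsRenewal

variable {P : Measure Ω} {θ : ℕ → Ω → ℝ}

theorem lintegral_renewalMeasure (h : IsRenewal P θ) {f : ℝ → ENNReal} (hf : Measurable f) :
    ∫⁻ t, f t ∂(renewalMeasure P θ) = ∫⁻ ω, ∑' i, f (arrival θ i ω) ∂P := by
  have hm := measurable_arrival h.measurable
  rw [renewalMeasure, lintegral_sum_measure, lintegral_tsum fun i =>
    (show Measurable fun ω => f (arrival θ i ω) from hf.comp (hm i)).aemeasurable]
  exact tsum_congr fun i => lintegral_map hf (hm i)

variable [IsProbabilityMeasure P]

/-- The product of two renewal measures is realised on `Ω` itself: the first coordinate is the gap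
to a later arrival, the second the earlier arrival time. -/
theorem lintegral_renewalMeasure_prod (h : IsRenewal P θ) {f : ℝ × ℝ → ENNReal}
    (hf : Measurable f) :
    ∫⁻ p, f p ∂((renewalMeasure P θ).prod (renewalMeasure P θ)) =
      ∫⁻ ω, ∑' i, ∑' j, f (arrival θ (j + i + 1) ω - arrival θ j ω, arrival θ j ω) ∂P := by
  have hm := measurable_arrival h.measurable
  have hmp : ∀ i j, Measurable fun ω =>
      (arrival θ (j + i + 1) ω - arrival θ j ω, arrival θ j ω) := fun i j =>
    ((hm _).sub (hm j)).prodMk (hm j)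
  have hfm : ∀ i j, Measurable fun ω =>
      f (arrival θ (j + i + 1) ω - arrival θ j ω, arrival θ j ω) := fun i j => hf.comp (hmp i j)
  rw [renewalMeasure, Measure.prod_sum, lintegral_sum_measure, ENNReal.tsum_prod',
    lintegral_tsum fun i => (Measurable.tsum (hfm i)).aemeasurable]
  refine tsum_congr fun i => ?_
  rw [lintegral_tsum fun j => (hfm i j).aemeasurable]
  refine tsum_congr fun j => ?_
  rw [← h.map_arrival_increment i j, lintegral_map hf (hmp i j)]

/-- Campbell-type formula: the expected sum over pairs of arrivals up to time `t`. -/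
theorem integral_sum_pairs (h : IsRenewal P θ) {φ ψ : ℝ → ℝ} (hφ : Measurable φ)
    (hψ : Measurable ψ) (hφ0 : ∀ u, 0 ≤ φ u) (hψ0 : ∀ u, 0 ≤ ψ u) {C : ℝ} (hC : 0 ≤ C) (t : ℝ)
    (hint : Integrable (fun ω => ∑ q ∈ Finset.range (counting θ t ω).toNat ×ˢ
      Finset.range (counting θ t ω).toNat, (if q.1 = q.2 then C else 1) *
        (φ (arrival θ q.1 ω) * ψ (arrival θ q.2 ω))) P) :
    ∫ ω, ∑ q ∈ Finset.range (counting θ t ω).toNat ×ˢ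
      Finset.range (counting θ t ω).toNat, (if q.1 = q.2 then C else 1) *
        (φ (arrival θ q.1 ω) * ψ (arrival θ q.2 ω)) ∂P =
    (∫ p in {p : ℝ × ℝ | 0 ≤ p.1 ∧ 0 ≤ p.2 ∧ p.1 + p.2 ≤ t},
      (φ (p.2 + p.1) * ψ p.2 + φ p.2 * ψ (p.2 + p.1))
        ∂((renewalMeasure P θ).prod (renewalMeasure P θ))) +
      C * ∫ u in Set.Icc 0 t, φ u * ψ u ∂(renewalMeasure P θ) := by
  set g : Ω → ℝ := fun ω => ∑ q ∈ Finset.range (counting θ t ω).toNat ×ˢ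
      Finset.range (counting θ t ω).toNat, (if q.1 = q.2 then C else 1) *
        (φ (arrival θ q.1 ω) * ψ (arrival θ q.2 ω)) with hg
  set S := {p : ℝ × ℝ | 0 ≤ p.1 ∧ 0 ≤ p.2 ∧ p.1 + p.2 ≤ t} with hSdef
  have hS : MeasurableSet S := by
    have h1 : MeasurableSet {p : ℝ × ℝ | 0 ≤ p.1} := measurableSet_le measurable_const measurable_fst
    have h2 : MeasurableSet {p : ℝ × ℝ | 0 ≤ p.2} := measurableSet_le measurable_const measurable_snd
    have h3 : MeasurableSet {p : ℝ × ℝ | p.1 + p.2 ≤ t} :=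
      measurableSet_le (measurable_fst.add measurable_snd) measurable_const
    exact h1.inter (h2.inter h3)
  have hm := measurable_arrival h.measurable
  have hkm : Measurable fun p : ℝ × ℝ => φ (p.2 + p.1) * ψ p.2 + φ p.2 * ψ (p.2 + p.1) := by
    fun_prop
  have hk0 : ∀ p : ℝ × ℝ, 0 ≤ φ (p.2 + p.1) * ψ p.2 + φ p.2 * ψ (p.2 + p.1) := fun p =>
    add_nonneg (mul_nonneg (hφ0 _) (hψ0 _)) (mul_nonneg (hφ0 _) (hψ0 _))
  have hdm : Measurable fun u : ℝ => φ u * ψ u := hφ.mul hψ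
  have hw0 : ∀ i j : ℕ, (0 : ℝ) ≤ if i = j then C else 1 := fun i j => by
    split_ifs <;> first | exact hC | norm_num
  have hg0 : ∀ ω, 0 ≤ g ω := fun ω => Finset.sum_nonneg fun q _ =>
    mul_nonneg (hw0 _ _) (mul_nonneg (hφ0 _) (hψ0 _))
  -- The two summands are the two orders in which the large claims of the families can occur; `S`
  -- says that the later one occurs by time `t`.
  set K : ℝ × ℝ → ENNReal := S.indicator fun p =>
    ENNReal.ofReal (φ (p.2 + p.1) * ψ p.2 + φ p.2 * ψ (p.2 + p.1)) with hK
  set D : ℝ → ENNReal := (Set.Icc 0 t).indicator fun u => ENNReal.ofReal (C * (φ u * ψ u)) with hD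
  have hKm : Measurable K := hkm.ennreal_ofReal.indicator hS
  have hDm : Measurable D := (hdm.const_mul C).ennreal_ofReal.indicator measurableSet_Icc
  have hpt : ∀ᵐ ω ∂P, ENNReal.ofReal (g ω) =
      (∑' i, ∑' j, K (arrival θ (j + i + 1) ω - arrival θ j ω, arrival θ j ω)) +
        ∑' i, D (arrival θ i ω) := by
    filter_upwards [h.ae_counting t, h.ae_pos] with ω hω hpos
    obtain ⟨-, hlt⟩ := hω
    have hmono : ∀ i j, i ≤ j → arrival θ i ω ≤ arrival θ j ω := fun i j hij =>
      Finset.sum_le_sum_of_subset_of_nonneg (Finset.range_mono (by omega))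
        fun k _ _ => (hpos k).le
    have hnn : ∀ i, 0 ≤ arrival θ i ω := fun i => Finset.sum_nonneg fun k _ => (hpos k).le
    set n := (counting θ t ω).toNat with hn
    set U : ℕ → ℕ → ENNReal := fun i j => if i < n ∧ j < n then
      ENNReal.ofReal ((if i = j then C else 1) *
        (φ (arrival θ i ω) * ψ (arrival θ j ω))) else 0 with hU
    have hgU : ENNReal.ofReal (g ω) = ∑' i, ∑' j, U i j := by
      rw [hg, ENNReal.ofReal_sum_of_nonneg fun q _ =>
        mul_nonneg (hw0 _ _) (mul_nonneg (hφ0 _) (hψ0 _)), ← ENNReal.tsum_prod,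
        tsum_eq_sum (s := Finset.range n ×ˢ Finset.range n)]
      · refine Finset.sum_congr rfl fun q hq => ?_
        simp only [Finset.mem_product, Finset.mem_range] at hq
        simp only [hU, hq, and_self, if_true]
      · intro q hq
        simp only [Finset.mem_product, Finset.mem_range] at hq
        simp only [hU, hq, if_false]
    rw [hgU, tsum_tsum_eq_offDiag_add_diag]
    congr 1
    · refine tsum_congr fun i => tsum_congr fun j => ?_
      have hne : j + i + 1 ≠ j := by omega
      by_cases hc : j + i + 1 < n
      · have hmem : (arrival θ (j + i + 1) ω - arrival θ j ω, arrival θ j ω) ∈ S :=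
          ⟨sub_nonneg.2 (hmono _ _ (by omega)), hnn j, by simpa using (hlt _).1 hc⟩
        have hj : j < n := by omega
        rw [hK, Set.indicator_of_mem hmem]
        simp only [hU, hc, hj, hne, hne.symm, and_self, if_true, if_false, one_mul,
          add_sub_cancel]
        rw [← ENNReal.ofReal_add (mul_nonneg (hφ0 _) (hψ0 _)) (mul_nonneg (hφ0 _) (hψ0 _))]
      · have hmem : (arrival θ (j + i + 1) ω - arrival θ j ω, arrival θ j ω) ∉ S := fun hm =>
          hc ((hlt _).2 (by simpa using hm.2.2))
        rw [hK, Set.indicator_of_notMem hmem]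
        simp [hU, hc]
    · refine tsum_congr fun i => ?_
      by_cases hc : i < n
      · have hmem : arrival θ i ω ∈ Set.Icc 0 t := ⟨hnn i, (hlt i).1 hc⟩
        rw [hD, Set.indicator_of_mem hmem]
        simp [hU, hc]
      · have hmem : arrival θ i ω ∉ Set.Icc 0 t := fun hm => hc ((hlt i).2 hm.2)
        rw [hD, Set.indicator_of_notMem hmem]
        simp [hU, hc]
  have htot : ∫⁻ ω, ENNReal.ofReal (g ω) ∂P =
      ∫⁻ p, K p ∂((renewalMeasure P θ).prod (renewalMeasure P θ)) +
        ∫⁻ u, D u ∂(renewalMeasure P θ) := by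
    rw [lintegral_congr_ae hpt, h.lintegral_renewalMeasure_prod hKm, h.lintegral_renewalMeasure hDm]
    refine lintegral_add_right _ (Measurable.tsum fun i => hDm.comp (hm i))
  -- Integrability makes both parts finite, so that `toReal` is additive on them.
  have hfin : ∫⁻ ω, ENNReal.ofReal (g ω) ∂P < ⊤ :=
    (hasFiniteIntegral_iff_ofReal (Eventually.of_forall hg0)).1 hint.hasFiniteIntegral
  rw [htot] at hfin
  obtain ⟨hf1, hf2⟩ := ENNReal.add_lt_top.1 hfin
  rw [integral_eq_lintegral_of_nonneg_ae (Eventually.of_forall hg0) hint.aestronglyMeasurable,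
    htot, ENNReal.toReal_add hf1.ne hf2.ne]
  congr 1
  · rw [hK, lintegral_indicator hS, integral_eq_lintegral_of_nonneg_ae
      (Eventually.of_forall hk0) hkm.aestronglyMeasurable]
  · rw [hD, lintegral_indicator measurableSet_Icc, ← integral_const_mul,
      integral_eq_lintegral_of_nonneg_ae (Eventually.of_forall fun u =>
        mul_nonneg hC (mul_nonneg (hφ0 _) (hψ0 _))) (hdm.const_mul C).aestronglyMeasurable]

end IsRenewal

end

variable {Ω : Type*}

/-! ### Discounted claims -/

/-- Sum over pairs of arrivals of the discounted marginal tails. -/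
def pairTail (F G : Measure ℝ) (r C : ℝ) (θ : ℕ → Ω → ℝ) (T : ℝ) (p : ℝ × ℝ) (ω : Ω) : ℝ :=
  ∑ q ∈ Finset.range (counting θ T ω).toNat ×ˢ Finset.range (counting θ T ω).toNat,
    (if q.1 = q.2 then C else 1) * (tail F (p.1 * Real.exp (r * arrival θ q.1 ω)) *
      tail G (p.2 * Real.exp (r * arrival θ q.2 ω)))

theorem pairTail_nonneg {F G : Measure ℝ} {r C : ℝ} (hC : 0 ≤ C) (θ : ℕ → Ω → ℝ) (T : ℝ)
    (p : ℝ × ℝ) (ω : Ω) : 0 ≤ pairTail F G r C θ T p ω :=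
  Finset.sum_nonneg fun q _ => mul_nonneg (by split_ifs <;> first | exact hC | norm_num)
    (mul_nonneg (tail_nonneg _ _) (tail_nonneg _ _))

/-- A crude upper bound for the sum of the discounted tails. -/
theorem pairTail_le {F G : Measure ℝ} [IsFiniteMeasure F] [IsFiniteMeasure G] {r C : ℝ}
    (hr : 0 ≤ r) (hC : 0 ≤ C) {θ : ℕ → Ω → ℝ} (T : ℝ) {p : ℝ × ℝ} (hp : 0 ≤ p.1 ∧ 0 ≤ p.2) {ω : Ω}
    (hω : ∀ i, 0 < θ i ω) :
    pairTail F G r C θ T p ω ≤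
      (1 + C) * ((counting θ T ω).toNat + 1) ^ 2 * (tail F p.1 * tail G p.2) := by
  have hnn : ∀ i, 0 ≤ arrival θ i ω := fun i => Finset.sum_nonneg fun k _ => (hω k).le
  have hexp : ∀ i, 1 ≤ Real.exp (r * arrival θ i ω) := fun i =>
    Real.one_le_exp (mul_nonneg hr (hnn i))
  set n := (counting θ T ω).toNat
  have hterm : ∀ q ∈ Finset.range n ×ˢ Finset.range n, (if q.1 = q.2 then C else 1) *
      (tail F (p.1 * Real.exp (r * arrival θ q.1 ω)) *
        tail G (p.2 * Real.exp (r * arrival θ q.2 ω))) ≤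
      (1 + C) * (tail F p.1 * tail G p.2) := fun q _ => by
    refine mul_le_mul (by split_ifs <;> linarith) (mul_le_mul
      (tail_antitone F (le_mul_of_one_le_right hp.1 (hexp _)))
      (tail_antitone G (le_mul_of_one_le_right hp.2 (hexp _))) (tail_nonneg _ _)
      (tail_nonneg _ _)) (mul_nonneg (tail_nonneg _ _) (tail_nonneg _ _)) (by linarith)
  refine (Finset.sum_le_card_nsmul _ _ _ hterm).trans ?_
  rw [nsmul_eq_mul, Finset.card_product, Finset.card_range, Nat.cast_mul]
  have h1 : (n : ℝ) * n ≤ (n + 1) ^ 2 := by nlinarith [(Nat.cast_nonneg n : (0 : ℝ) ≤ n)]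
  have h2 : 0 ≤ (1 + C) * (tail F p.1 * tail G p.2) :=
    mul_nonneg (by linarith) (mul_nonneg (tail_nonneg _ _) (tail_nonneg _ _))
  calc _ ≤ ((n : ℝ) + 1) ^ 2 * ((1 + C) * (tail F p.1 * tail G p.2)) :=
        mul_le_mul_of_nonneg_right h1 h2
    _ = _ := by ring

variable [MeasurableSpace Ω]

/-- The joint tail of the claims `X i` and `Y j`, discounted along fixed arrival times. -/
def conditionalTail (P : Measure Ω) (r : ℝ) (θ X Y : ℕ → Ω → ℝ) (T : ℝ) (p : ℝ × ℝ) (ω : Ω) : ℝ :=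
  P.real {ω' | p.1 < ∑ i ∈ Finset.range (counting θ T ω).toNat,
      X i ω' * Real.exp (-r * arrival θ i ω) ∧
    p.2 < ∑ i ∈ Finset.range (counting θ T ω).toNat, Y i ω' * Real.exp (-r * arrival θ i ω)}

/-- Disintegration along the arrival times, which are independent of the claims. -/
theorem measurable_conditionalTail_and_integral_eq {P : Measure Ω} [IsProbabilityMeasure P]
    {X Y θ : ℕ → Ω → ℝ} (hX : ∀ i, Measurable (X i)) (hY : ∀ i, Measurable (Y i))
    (hθ : ∀ i, Measurable (θ i))
    (hindep : IndepFun (fun ω (i : ℕ) => (X i ω, Y i ω)) (fun ω (i : ℕ) => θ i ω) P)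
    (r T : ℝ) (p : ℝ × ℝ) :
    Measurable (conditionalTail P r θ X Y T p) ∧
      P.real {ω | p.1 < discountedClaims r θ X T ω ∧ p.2 < discountedClaims r θ Y T ω} =
        ∫ ω, conditionalTail P r θ X Y T p ω ∂P := by
  set W : Ω → ℕ → ℝ × ℝ := fun ω i => (X i ω, Y i ω)
  set Θ : Ω → ℕ → ℝ := fun ω i => θ i ω
  have hW : Measurable W := measurable_pi_lambda _ fun i => (hX i).prodMk (hY i)
  have hΘ : Measurable Θ := measurable_pi_lambda _ hθ
  -- The coordinate maps on the space of values: the event becomes a measurable set `A` there, to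
  -- which Tonelli's theorem for the product law applies.
  set θ' : ℕ → (ℕ → ℝ × ℝ) × (ℕ → ℝ) → ℝ := fun i z => z.2 i
  set X' : ℕ → (ℕ → ℝ × ℝ) × (ℕ → ℝ) → ℝ := fun i z => (z.1 i).1
  set Y' : ℕ → (ℕ → ℝ × ℝ) × (ℕ → ℝ) → ℝ := fun i z => (z.1 i).2
  have hθ' : ∀ i, Measurable (θ' i) := fun i => (measurable_pi_apply i).comp measurable_snd
  have hX' : ∀ i, Measurable (X' i) := fun i =>
    measurable_fst.comp ((measurable_pi_apply i).comp measurable_fst)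
  have hY' : ∀ i, Measurable (Y' i) := fun i =>
    measurable_snd.comp ((measurable_pi_apply i).comp measurable_fst)
  set A : Set ((ℕ → ℝ × ℝ) × (ℕ → ℝ)) :=
    {z | p.1 < discountedClaims r θ' X' T z ∧ p.2 < discountedClaims r θ' Y' T z}
  have hA : MeasurableSet A :=
    (measurableSet_lt measurable_const (measurable_discountedClaims r hθ' hX' T)).inter
      (measurableSet_lt measurable_const (measurable_discountedClaims r hθ' hY' T))
  have hcond : ∀ ω, conditionalTail P r θ X Y T p ω =
      (P.map W ((fun w => (w, Θ ω)) ⁻¹' A)).toReal := fun ω => by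
    rw [Measure.map_apply hW (measurable_prodMk_right hA)]
    rfl
  have hm : Measurable fun ω => P.map W ((fun w => (w, Θ ω)) ⁻¹' A) :=
    (measurable_measure_prodMk_right hA).comp hΘ
  have hWprob : IsProbabilityMeasure (P.map W) := Measure.isProbabilityMeasure_map hW.aemeasurable
  refine ⟨funext hcond ▸ hm.ennreal_toReal, ?_⟩
  have h1 : P {ω | p.1 < discountedClaims r θ X T ω ∧ p.2 < discountedClaims r θ Y T ω} =
      ∫⁻ ω, P.map W ((fun w => (w, Θ ω)) ⁻¹' A) ∂P := by
    calc _ = P.map (fun ω => (W ω, Θ ω)) A := by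
          rw [Measure.map_apply (hW.prodMk hΘ) hA]; rfl
      _ = ∫⁻ ϑ, P.map W ((fun w => (w, ϑ)) ⁻¹' A) ∂(P.map Θ) := by
          rw [hindep.map_prod_eq_prod_map_map hW.aemeasurable hΘ.aemeasurable,
            Measure.prod_apply_symm hA]
      _ = _ := lintegral_map (measurable_measure_prodMk_right hA) hΘ
  simp only [hcond]
  rw [measureReal_def, h1, integral_toReal hm.aemeasurable
    (Eventually.of_forall fun ω => measure_lt_top _ _)]

theorem measurable_pairTail {θ : ℕ → Ω → ℝ} (hθ : ∀ i, Measurable (θ i)) (F G : Measure ℝ)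
    [IsFiniteMeasure F] [IsFiniteMeasure G] (r C T : ℝ) (p : ℝ × ℝ) :
    Measurable (pairTail F G r C θ T p) := by
  refine measurable_apply_nat (measurable_counting_toNat hθ T) (f := fun n ω =>
    ∑ q ∈ Finset.range n ×ˢ Finset.range n, (if q.1 = q.2 then C else 1) *
      (tail F (p.1 * Real.exp (r * arrival θ q.1 ω)) *
        tail G (p.2 * Real.exp (r * arrival θ q.2 ω)))) fun n => ?_
  have hF := measurable_tail F
  have hG := measurable_tail G
  have hm := measurable_arrival hθ
  exact Finset.measurable_fun_sum _ fun q _ =>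
    ((hF.comp (((hm q.1).const_mul r).exp.const_mul p.1)).mul
      (hG.comp (((hm q.2).const_mul r).exp.const_mul p.2))).const_mul _

/-! ### Averaging over the arrival times -/

variable {P : Measure Ω} [IsProbabilityMeasure P] {X Y θ : ℕ → Ω → ℝ} {F G : Measure ℝ}
  [IsProbabilityMeasure F] [IsProbabilityMeasure G] {r C T : ℝ}

theorem integrable_pairTail (hθ : IsRenewal P θ) (hr : 0 ≤ r) (hC : 0 ≤ C) {p : ℝ × ℝ}
    (hp : 0 ≤ p.1 ∧ 0 ≤ p.2) : Integrable (pairTail F G r C θ T p) P := by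
  refine (((hθ.integrable_counting_pow T 2).const_mul (1 + C)).mul_const
    (tail F p.1 * tail G p.2)).mono' (measurable_pairTail hθ.measurable F G r C T
      p).aestronglyMeasurable ?_
  filter_upwards [hθ.ae_pos] with ω hω
  rw [Real.norm_of_nonneg (pairTail_nonneg hC θ T p ω)]
  exact pairTail_le hr hC T hp hω

theorem integral_pairTail (hθ : IsRenewal P θ) (hr : 0 ≤ r) (hC : 0 ≤ C) {p : ℝ × ℝ}
    (hp : 0 ≤ p.1 ∧ 0 ≤ p.2) : ∫ ω, pairTail F G r C θ T p ω ∂P =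
      deltaAsymp F G (renewalMeasure P θ) r C T p.1 p.2 :=
  hθ.integral_sum_pairs (φ := fun u => tail F (p.1 * Real.exp (r * u)))
    (ψ := fun u => tail G (p.2 * Real.exp (r * u)))
    ((measurable_tail F).comp ((measurable_id.const_mul r).exp.const_mul p.1))
    ((measurable_tail G).comp ((measurable_id.const_mul r).exp.const_mul p.2))
    (fun _ => tail_nonneg _ _) (fun _ => tail_nonneg _ _) hC T (integrable_pairTail hθ hr hC hp)

/-- The joint tail of the discounted claims differs from `Δ` by a term of smaller order than
`F̄(x) Ḡ(y)`. -/
theorem FactorizingTails.tendsto_discounted_sub (h : FactorizingTails P X Y F G C)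
    (hθ : IsRenewal P θ) (hr : 0 ≤ r) (hC : 0 ≤ C)
    (hindep : IndepFun (fun ω (i : ℕ) => (X i ω, Y i ω)) (fun ω (i : ℕ) => θ i ω) P) :
    Tendsto (fun p : ℝ × ℝ =>
      (P.real {ω | p.1 < discountedClaims r θ X T ω ∧ p.2 < discountedClaims r θ Y T ω} -
        deltaAsymp F G (renewalMeasure P θ) r C T p.1 p.2) / (tail F p.1 * tail G p.2))
      minAtTop (𝓝 0) := by
  obtain ⟨K, x₀, q, hK, hx₀, hb⟩ := h.exists_sum_tail_bound
  have hdis := fun p => measurable_conditionalTail_and_integral_eq h.measurable_left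
    h.measurable_right hθ.measurable hindep r T p
  have hlim : Tendsto (fun p : ℝ × ℝ => ∫ ω, (conditionalTail P r θ X Y T p ω -
      pairTail F G r C θ T p ω) / (tail F p.1 * tail G p.2) ∂P) minAtTop (𝓝 (∫ _, 0 ∂P)) := by
    -- The dominating function is polynomial in `N(T)`: the Kesten-type bound for the conditional
    -- tail plus the crude bound for the sum over pairs.
    refine tendsto_integral_filter_of_dominated_convergence
      (fun ω => K * (((counting θ T ω).toNat : ℝ) + 1) ^ q +
        (1 + C) * (((counting θ T ω).toNat : ℝ) + 1) ^ 2)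
      (Eventually.of_forall fun p => (((hdis p).1.sub
        (measurable_pairTail hθ.measurable F G r C T p)).div_const _).aestronglyMeasurable)
      ?_ (((hθ.integrable_counting_pow T q).const_mul K).add
        ((hθ.integrable_counting_pow T 2).const_mul (1 + C))) ?_
    · filter_upwards [eventually_minAtTop_ge x₀] with p hp
      filter_upwards [hθ.ae_pos] with ω hω
      have hnn : ∀ i, 0 ≤ arrival θ i ω := fun i => Finset.sum_nonneg fun k _ => (hω k).le
      have hR := h.mul_pos p.1 p.2
      have h1 : conditionalTail P r θ X Y T p ω ≤ K * (((counting θ T ω).toNat : ℝ) + 1) ^ q *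
          (tail F p.1 * tail G p.2) :=
        hb (fun i => Real.exp (-r * arrival θ i ω)) (fun i => Real.exp_pos _)
          (fun i => Real.exp_le_one_iff.2 (by nlinarith [mul_nonneg hr (hnn i)])) _ p hp.1 hp.2
      have h2 := pairTail_le (F := F) (G := G) hr hC T (p := p)
        ⟨hx₀.le.trans hp.1, hx₀.le.trans hp.2⟩ hω
      have h3 : 0 ≤ conditionalTail P r θ X Y T p ω := measureReal_nonneg
      have h4 := pairTail_nonneg (F := F) (G := G) (r := r) hC θ T p ω
      rw [norm_div, Real.norm_of_nonneg hR.le, div_le_iff₀ hR, add_mul]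
      refine (norm_sub_le _ _).trans ?_
      rw [Real.norm_of_nonneg h3, Real.norm_of_nonneg h4]
      exact add_le_add h1 h2
    -- For fixed `ω` the weights and the number of claims are deterministic, and the finite-sum
    -- asymptotics apply.
    · filter_upwards [hθ.ae_pos] with ω hω
      have hnn : ∀ i, 0 ≤ arrival θ i ω := fun i => Finset.sum_nonneg fun k _ => (hω k).le
      have hinv : ∀ (x : ℝ) i, x / Real.exp (-r * arrival θ i ω) =
          x * Real.exp (r * arrival θ i ω) := fun x i => by
        rw [neg_mul, Real.exp_neg, div_inv_eq_mul]
      have := h.tendsto_sum_tail (a := fun i => Real.exp (-r * arrival θ i ω))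
        (fun i => Real.exp_pos _)
        (fun i => Real.exp_le_one_iff.2 (by nlinarith [mul_nonneg hr (hnn i)]))
        (counting θ T ω).toNat
      simp only [hinv] at this
      exact this
  rw [integral_zero] at hlim
  refine hlim.congr' ?_
  filter_upwards [eventually_minAtTop_ge 0] with p hp
  have hint : Integrable (conditionalTail P r θ X Y T p) P :=
    Integrable.of_bound (hdis p).1.aestronglyMeasurable 1 (Eventually.of_forall fun ω => by
      exact (Real.norm_of_nonneg measureReal_nonneg).trans_le measureReal_le_one)
  rw [integral_div, integral_sub hint (integrable_pairTail hθ hr hC hp), ← (hdis p).2,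
    integral_pairTail hθ hr hC hp]

/-- `Δ` is at least of the order `F̄(x) Ḡ(y)`. -/
theorem FactorizingTails.exists_le_deltaAsymp (h : FactorizingTails P X Y F G C)
    (hθ : IsRenewal P θ) (hr : 0 ≤ r) (hC : 0 < C) (hlam : 0 < renewalFunction P θ T) :
    ∃ c > 0, ∀ᶠ p : ℝ × ℝ in minAtTop,
      c * (tail F p.1 * tail G p.2) ≤ deltaAsymp F G (renewalMeasure P θ) r C T p.1 p.2 := by
  obtain ⟨K, x₀, q, hK, hx₀, hb⟩ := h.exists_scaling_bound
  -- Arrivals up to `T` multiply the levels by at most `e^{r T} ≤ n`, which the scaling bound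
  -- absorbs.
  obtain ⟨n, hn⟩ := exists_nat_ge (Real.exp (r * T))
  have hn0 : (0 : ℝ) < n := (Real.exp_pos _).trans_le hn
  have hn1 : 1 ≤ n := by exact_mod_cast hn0
  have hS : MeasurableSet {ω | (counting θ T ω).toNat ≠ 0} :=
    measurable_counting_toNat hθ.measurable T (measurableSet_singleton 0).compl
  have hpos : 0 < P.real {ω | (counting θ T ω).toNat ≠ 0} := by
    refine measureReal_nonneg.lt_of_ne' fun h0 => hlam.ne' ?_
    have hnull : ∀ᵐ ω ∂P, (counting θ T ω).toNat = 0 := by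
      rw [measureReal_eq_zero_iff] at h0
      exact ae_iff.2 h0
    rw [renewalFunction, lintegral_eq_zero_of_ae_eq_zero]
    filter_upwards [hnull, hθ.ae_counting T] with ω h1 h2
    rw [h2.1, h1]
    simp
  refine ⟨P.real {ω | (counting θ T ω).toNat ≠ 0} * (C / (K * n ^ q)), by positivity, ?_⟩
  filter_upwards [eventually_minAtTop_ge x₀] with p hp
  have hp0 : 0 ≤ p.1 ∧ 0 ≤ p.2 := ⟨hx₀.le.trans hp.1, hx₀.le.trans hp.2⟩
  rw [← integral_pairTail hθ hr hC.le hp0]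
  have hR := h.mul_pos p.1 p.2
  have hscale : tail F p.1 * tail G p.2 / (K * n ^ q) ≤
      tail F (p.1 * Real.exp (r * T)) * tail G (p.2 * Real.exp (r * T)) := by
    have h1 := hb n hn1 (p.1 * n) (p.2 * n)
      (hp.1.trans (le_mul_of_one_le_right hp0.1 (by exact_mod_cast hn1)))
      (hp.2.trans (le_mul_of_one_le_right hp0.2 (by exact_mod_cast hn1)))
    rw [mul_div_cancel_right₀ _ hn0.ne', mul_div_cancel_right₀ _ hn0.ne'] at h1
    rw [div_le_iff₀' (by positivity)]
    refine h1.trans (mul_le_mul_of_nonneg_left ?_ (by positivity))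
    exact mul_le_mul (tail_antitone F (mul_le_mul_of_nonneg_left hn hp0.1))
      (tail_antitone G (mul_le_mul_of_nonneg_left hn hp0.2)) (tail_nonneg _ _) (tail_nonneg _ _)
  calc _ = ∫ ω, Set.indicator {ω | (counting θ T ω).toNat ≠ 0}
        (fun _ => C * (tail F p.1 * tail G p.2 / (K * n ^ q))) ω ∂P := by
        rw [integral_indicator_const _ hS, smul_eq_mul]; ring
    _ ≤ ∫ ω, pairTail F G r C θ T p ω ∂P := by
      refine integral_mono_ae ((integrable_const _).indicator hS)
        (integrable_pairTail hθ hr hC.le hp0) ?_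
      filter_upwards [hθ.ae_counting T] with ω hω
      by_cases hN : ω ∈ {ω | (counting θ T ω).toNat ≠ 0}
      · have h0 : 0 < (counting θ T ω).toNat := Nat.pos_of_ne_zero hN
        have hexp : Real.exp (r * arrival θ 0 ω) ≤ Real.exp (r * T) :=
          Real.exp_le_exp.2 (mul_le_mul_of_nonneg_left ((hω.2 0).1 h0) hr)
        rw [Set.indicator_of_mem hN]
        calc _ ≤ C * (tail F (p.1 * Real.exp (r * arrival θ 0 ω)) *
              tail G (p.2 * Real.exp (r * arrival θ 0 ω))) :=
              mul_le_mul_of_nonneg_left (hscale.trans (mul_le_mul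
                (tail_antitone F (mul_le_mul_of_nonneg_left hexp hp0.1))
                (tail_antitone G (mul_le_mul_of_nonneg_left hexp hp0.2)) (tail_nonneg _ _)
                (tail_nonneg _ _))) hC.le
          _ ≤ pairTail F G r C θ T p ω := by
            -- The diagonal term of the first arrival, of weight `C`, is enough.
            have hmem : ((0, 0) : ℕ × ℕ) ∈ Finset.range (counting θ T ω).toNat ×ˢ
                Finset.range (counting θ T ω).toNat :=
              Finset.mk_mem_product (Finset.mem_range.2 h0) (Finset.mem_range.2 h0)
            refine le_trans (le_of_eq ?_) (Finset.single_le_sum (fun q _ => mul_nonneg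
              (by split_ifs <;> first | exact hC.le | norm_num)
              (mul_nonneg (tail_nonneg _ _) (tail_nonneg _ _))) hmem)
            simp
      · rw [Set.indicator_of_notMem hN]
        exact pairTail_nonneg hC.le θ T p ω

end RiskModel

end

theorem mainTheorem4 {Ω : Type*} [MeasurableSpace Ω] (P : Measure Ω) [IsProbabilityMeasure P]
    (X Y θ : ℕ → Ω → ℝ) (F G : Measure ℝ) (r C T : ℝ)
    (hr : 0 ≤ r)
    (hX : ∀ i, Measurable (X i)) (hY : ∀ i, Measurable (Y i))
    -- the claim pairs are identically distributed, with marginal distributions `F`, `G`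
    (hident : ∀ i, IdentDistrib (fun ω => (X i ω, Y i ω)) (fun ω => (X 0 ω, Y 0 ω)) P P)
    (hF : P.map (X 0) = F) (hG : P.map (Y 0) = G)
    (hFL : RiskModel.LongTailed F) (hFD : RiskModel.DominatedlyVarying F)
    (hGL : RiskModel.LongTailed G) (hGD : RiskModel.DominatedlyVarying G)
    -- dependence among the claims
    (hGTAI : ∀ n m : ℕ, RiskModel.IsGTAI P (fun i : Fin n => X i) (fun j : Fin m => Y j))
    (hSAI : ∀ i, RiskModel.IsSAI P (X i) (Y i) C)
    (hXY : ∀ i j, i ≠ j → IndepFun (X i) (Y j) P)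
    -- renewal arrivals, independent of the claims
    (hθ : RiskModel.IsRenewal P θ)
    (hindep : IndepFun (fun ω (i : ℕ) => (X i ω, Y i ω)) (fun ω (i : ℕ) => θ i ω) P)
    (hT : 0 < T) (hlam : 0 < RiskModel.renewalFunction P θ T) :
    Tendsto
      (fun p : ℝ × ℝ =>
        P.real {ω | p.1 < RiskModel.discountedClaims r θ X T ω ∧
            p.2 < RiskModel.discountedClaims r θ Y T ω} /
          RiskModel.deltaAsymp F G (RiskModel.renewalMeasure P θ) r C T p.1 p.2)
      RiskModel.minAtTop (𝓝 1) := by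
  subst hF hG
  have : IsProbabilityMeasure (P.map (X 0)) := Measure.isProbabilityMeasure_map (hX 0).aemeasurable
  have : IsProbabilityMeasure (P.map (Y 0)) := Measure.isProbabilityMeasure_map (hY 0).aemeasurable
  have h := RiskModel.IsGTAI.factorizingTails hX hY hident hFL hFD hGL hGD hGTAI hSAI hXY
  have hC := (hSAI 0).pos
  obtain ⟨c, hc, hle⟩ := h.exists_le_deltaAsymp hθ hr hC hlam
  have hsub := h.tendsto_discounted_sub (T := T) hθ hr hC.le hindep
  have hzero : Tendsto (fun p : ℝ × ℝ =>
      P.real {ω | p.1 < RiskModel.discountedClaims r θ X T ω ∧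
            p.2 < RiskModel.discountedClaims r θ Y T ω} /
          RiskModel.deltaAsymp (P.map (X 0)) (P.map (Y 0)) (RiskModel.renewalMeasure P θ) r C T
            p.1 p.2 - 1) RiskModel.minAtTop (𝓝 0) := by
    -- The relative error is the additive one divided by `Δ`, and `Δ` is at least `c` times the
    -- product of the tails.
    have hbound := hsub.norm.const_mul c⁻¹
    rw [norm_zero, mul_zero] at hbound
    refine squeeze_zero_norm' ?_ hbound
    filter_upwards [hle] with p hp
    have hR := h.mul_pos p.1 p.2
    have hΔ := (mul_pos hc hR).trans_le hp
    rw [div_sub_one hΔ.ne', norm_div, norm_div, Real.norm_of_nonneg hR.le,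
      Real.norm_of_nonneg hΔ.le, inv_mul_eq_div, div_div, mul_comm _ c]
    exact div_le_div_of_nonneg_left (norm_nonneg _) (mul_pos hc hR) hp
  simpa using hzero.add_const 1
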